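/- Let $d\ge 1$, $2<p\le\infty$ (with $1/p=0$ for $p=\infty$), $\nu>\eta\ge 0$, $\delta>0$. Let $F\colon S'\to S'$ be the Fourier transform on the tempered distributions on $\mathbb R^d$ normalized by $Fx(\xi)=\int_{\mathbb R^d} x(t)e^{-i\langle t,\xi\rangle}\,dt$. Let $\psi\colon\mathbb R^d\to\mathbb C$ be a Lebesgue measurable function such that $|\psi|$ is homogeneous of degree $\eta$, i.e. $|\psi(t\xi)|=t^\eta|\psi(\xi)|$ for $t>0$, $\psi\ne0$ almost everywhere, $\psi$ is invariant under interchanging any two coordinates of its argument, and $|\psi|$ is continuous on the unit sphere $\mathbb S^{d-1}$. Put $$\Lambda x=F^{-1}(\psi\, Fx),\qquad D^{\nu e_j}x=F^{-1}\bigl((i\xi_j)^{\nu}Fx\bigr),\quad j=1,\dots,d,$$ $$X_p=\{x\in S': Fx\in L_p(\mathbb R^d),\ (i\xi_j)^\nu Fx\in L_2(\mathbb R^d),\ j=1,\dots,d\},$$ $$W_p=\{x\in X_p:\|D^{\nu e_j}x\|_{L_2(\mathbb R^d)}\le1,\ j=1,\dots,d\}.$$ The error of a method, i.e. of an arbitrary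 map $m\colon L_p(\mathbb R^d)\to L_2(\mathbb R^d)$, is $$e(m)=\sup\{\|\Lambda x-m(y)\|_{L_2(\mathbb R^d)}: x\in W_p,\ y\in L_p(\mathbb R^d),\ \|Fx-y\|_{L_p(\mathbb R^d)}\le\delta\},$$ $E=\inf_m e(m)$ is the optimal recovery error, and $m$ is optimal if $e(m)=E$. Put $$\tilde\gamma=\frac{\nu-\eta}{\nu+d(1/2-1/p)},\qquad \tilde q=\frac1{\tilde\gamma(1/2-1/p)},$$ $$C=\tilde\gamma^{-\tilde\gamma/p}\Bigl(\frac{1-\tilde\gamma}d\Bigr)^{-(1-\tilde\gamma)/2}\Bigl(\frac{B(\tilde q\tilde\gamma/p+1,\ \tilde q(1-\tilde\gamma)/2)}{2|\nu-\eta|}\Bigr)^{1/\tilde q},$$ $$I=\int_{\mathbb S^{d-1}}\frac{|\psi(\omega)|^{\tilde q}}{\bigl(\sum_{k=1}^d|\omega_k|^{2\nu}\bigr)^{\tilde q(1-\tilde\gamma)/2}}\,d\sigma(\omega),\qquad K=\frac1{(2\pi)^{d\tilde\gamma/2}}\,C\,I^{1/\tilde q},$$ where $B$ is the beta function and $\sigma$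 is the surface measure on $\mathbb S^{d-1}$ (counting measure on $\{-1,1\}$ for $d=1$). Then $I<\infty$, $\Lambda x\in L_2(\mathbb R^d)$ for all $x\in X_p$, and the following holds. (1) $E=K\delta^{\tilde\gamma}$. (2) With $$\beta=\frac{1-\tilde\gamma}{d(2\pi)^{d\tilde\gamma}}\,C^2\bigl(\delta I^{1/2-1/p}\bigr)^{2\tilde\gamma},$$ the formula $$\widehat m(y)=F^{-1}\left(\Bigl(1-\beta\,\frac{\sum_{j=1}^d|\xi_j|^{2\nu}}{|\psi(\xi)|^2}\Bigr)_+\psi(\xi)y(\xi)\right)$$ defines a map $\widehat m\colon L_p(\mathbb R^d)\to L_2(\mathbb R^d)$, and this method is optimal. (3) For all $x\in X_p$ $$\|\Lambda x\|_{L_2(\mathbb R^d)}\le K\,\|Fx\|_{L_p(\mathbb R^d)}^{\tilde\gamma}\Bigl(\max_{1\le j\le d}\|D^{\nu e_j}x\|_{L_2(\mathbb R^d)}\Bigr)^{1-\tilde\gamma},$$ and $K$ is the smallest nonnegative constant with this property. -/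

import Mathlib

open MeasureTheory
open scoped ENNReal SchwartzMap FourierTransform

namespace OptRecovery

noncomputable section

/-- The Euclidean space `ℝᵈ`. -/
abbrev E (d : ℕ) : Type := EuclideanSpace ℝ (Fin d)

/-! ### The Fourier transform `Fx(ξ) = ∫ x(t) exp(-i⟨t, ξ⟩) dt` on tempered distributions

Mathlib's `𝓕` uses the kernel `exp(-2πi⟨t, ξ⟩)`; the two differ by a dilation. -/

/-- The dilation `t ↦ c t` as a linear automorphism of `ℝᵈ`. -/
def dilation (d : ℕ) (c : ℝ) (hc : c ≠ 0) : E d ≃L[ℝ] E d :=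
  ContinuousLinearEquiv.smulLeft (Units.mk0 c hc)

lemma two_pi_ne_zero : (2 * Real.pi : ℝ) ≠ 0 := by positivity

/-- `F` on the Schwartz space. -/
def schwartzF (d : ℕ) : 𝓢(E d, ℂ) →L[ℂ] 𝓢(E d, ℂ) :=
  (SchwartzMap.compCLMOfContinuousLinearEquiv ℂ
    (dilation d (2 * Real.pi)⁻¹ (inv_ne_zero two_pi_ne_zero))) ∘L
    (FourierTransform.fourierCLM ℂ 𝓢(E d, ℂ))

/-- `F⁻¹` on the Schwartz space. -/
def schwartzFinv (d : ℕ) : 𝓢(E d, ℂ) →L[ℂ] 𝓢(E d, ℂ) :=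
  (FourierTransform.fourierInvCLM ℂ 𝓢(E d, ℂ)) ∘L
    (SchwartzMap.compCLMOfContinuousLinearEquiv ℂ
      (dilation d (2 * Real.pi) two_pi_ne_zero))

lemma schwartzF_apply (d : ℕ) (s : 𝓢(E d, ℂ)) (ξ : E d) :
    schwartzF d s ξ = ∫ t, Complex.exp (-(Complex.I * (inner ℝ t ξ : ℝ))) * s t := by
  have h : schwartzF d s ξ = 𝓕 (s : E d → ℂ) ((2 * Real.pi)⁻¹ • ξ) := by
    rw [← SchwartzMap.fourier_coe]
    rfl
  rw [h, Real.fourier_eq']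
  congr 1
  ext t
  rw [inner_smul_right, smul_eq_mul]
  congr 2
  push_cast
  have : (Real.pi : ℂ) ≠ 0 := by exact_mod_cast Real.pi_ne_zero
  field_simp

lemma schwartzFinv_schwartzF (d : ℕ) (s : 𝓢(E d, ℂ)) :
    schwartzFinv d (schwartzF d s) = s := by
  have h : (SchwartzMap.compCLMOfContinuousLinearEquiv ℂ
      (dilation d (2 * Real.pi) two_pi_ne_zero)) (schwartzF d s) = 𝓕 s := by
    ext t
    change (𝓕 s) ((2 * Real.pi)⁻¹ • ((2 * Real.pi) • t)) = (𝓕 s) t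
    rw [inv_smul_smul₀ two_pi_ne_zero]
  change 𝓕⁻ ((SchwartzMap.compCLMOfContinuousLinearEquiv ℂ
    (dilation d (2 * Real.pi) two_pi_ne_zero)) (schwartzF d s)) = s
  rw [h, FourierTransform.fourierInv_fourier_eq]

lemma schwartzF_schwartzFinv (d : ℕ) (s : 𝓢(E d, ℂ)) :
    schwartzF d (schwartzFinv d s) = s := by
  ext t
  change (𝓕 (𝓕⁻ ((SchwartzMap.compCLMOfContinuousLinearEquiv ℂ
    (dilation d (2 * Real.pi) two_pi_ne_zero)) s))) ((2 * Real.pi)⁻¹ • t) = s t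
  rw [FourierTransform.fourier_fourierInv_eq]
  change s ((2 * Real.pi) • ((2 * Real.pi)⁻¹ • t)) = s t
  rw [smul_inv_smul₀ two_pi_ne_zero]

/-- `F : S' → S'`, `⟨Fx, s⟩ = ⟨x, Fs⟩`. -/
def F {d : ℕ} (x : 𝓢'(E d, ℂ)) : 𝓢'(E d, ℂ) :=
  PointwiseConvergenceCLM.precomp ℂ (schwartzF d) x

/-- `F⁻¹ : S' → S'`, `⟨F⁻¹x, s⟩ = ⟨x, F⁻¹s⟩`. -/
def Finv {d : ℕ} (x : 𝓢'(E d, ℂ)) : 𝓢'(E d, ℂ) :=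
  PointwiseConvergenceCLM.precomp ℂ (schwartzFinv d) x

lemma F_Finv {d : ℕ} (x : 𝓢'(E d, ℂ)) : F (Finv x) = x := by
  ext s
  change x (schwartzFinv d (schwartzF d s)) = x s
  rw [schwartzFinv_schwartzF]

lemma Finv_F {d : ℕ} (x : 𝓢'(E d, ℂ)) : Finv (F x) = x := by
  ext s
  change x (schwartzF d (schwartzFinv d s)) = x s
  rw [schwartzF_schwartzFinv]

/-! ### Regular distributions -/

/-- The tempered distribution `u` is given by the function `f`. -/
def IsDensity {d : ℕ} (u : 𝓢'(E d, ℂ)) (f : E d → ℂ) : Prop :=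
  AEStronglyMeasurable f volume ∧
    ∀ s : 𝓢(E d, ℂ), Integrable (fun ξ => s ξ * f ξ) volume ∧ u s = ∫ ξ, s ξ * f ξ

open Classical in
/-- The tempered distribution given by the function `f` (`0` if there is none). -/
def funcDist {d : ℕ} (f : E d → ℂ) : 𝓢'(E d, ℂ) :=
  if h : ∃ u : 𝓢'(E d, ℂ), IsDensity u f then h.choose else 0

open Classical in
/-- The function (unique up to null sets) which gives the tempered distribution `u`
(`0` if there is none). -/
def density {d : ℕ} (u : 𝓢'(E d, ℂ)) : E d → ℂ :=
  if h : ∃ f : E d → ℂ, IsDensity u f then h.choose else 0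

/-- The `L_q`-norm of a tempered distribution: the norm of the element of `L_q` which gives it,
and `∞` if it is not given by an element of `L_q`. -/
def lqNorm {d : ℕ} (q : ℝ≥0∞) [Fact (1 ≤ q)] (u : 𝓢'(E d, ℂ)) : ℝ≥0∞ :=
  ⨅ (g : Lp ℂ q (volume : Measure (E d))) (_ : (g : 𝓢'(E d, ℂ)) = u), ‖g‖ₑ

/-! ### The recovery problem -/

/-- The operator `x ↦ F⁻¹(φ · Fx)`. -/
def multOp {d : ℕ} (φ : E d → ℂ) (x : 𝓢'(E d, ℂ)) : 𝓢'(E d, ℂ) :=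
  Finv (funcDist (fun ξ => φ ξ * density (F x) ξ))

/-- The space `X_p` of all `x ∈ S'` with `Fx ∈ L_p` and `φ_j Fx ∈ L_2` for all `j`. -/
def spaceX {d n : ℕ} (p : ℝ≥0∞) [Fact (1 ≤ p)] (φ : Fin n → E d → ℂ) : Set 𝓢'(E d, ℂ) :=
  {x | ∃ f : Lp ℂ p (volume : Measure (E d)), F x = (f : 𝓢'(E d, ℂ)) ∧
    ∀ j, MemLp (fun ξ => φ j ξ * f ξ) 2 volume}

/-- The class `W_p` of all `x ∈ X_p` with `‖D_j x‖_{L_2} ≤ 1` for all `j`, where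
`D_j x = F⁻¹(φ_j Fx)`. -/
def classW {d n : ℕ} (p : ℝ≥0∞) [Fact (1 ≤ p)] (φ : Fin n → E d → ℂ) : Set 𝓢'(E d, ℂ) :=
  {x | x ∈ spaceX p φ ∧ ∀ j, lqNorm 2 (multOp (φ j) x) ≤ 1}

/-- A recovery method: an arbitrary map `L_p(ℝᵈ) → L_2(ℝᵈ)`. -/
abbrev Method (d : ℕ) (p : ℝ≥0∞) : Type :=
  Lp ℂ p (volume : Measure (E d)) → Lp ℂ 2 (volume : Measure (E d))

/-- The error of the method `m` for the operator `Λx = F⁻¹(ψ Fx)`: the supremum of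
`‖Λx - m(y)‖_{L_2}` over `x ∈ W_p`, `y ∈ L_p` with `‖Fx - y‖_{L_p} ≤ δ`. -/
def methodError {d n : ℕ} (p : ℝ≥0∞) [Fact (1 ≤ p)] (ψ : E d → ℂ) (φ : Fin n → E d → ℂ)
    (δ : ℝ) (m : Method d p) : ℝ≥0∞ :=
  ⨆ (x : 𝓢'(E d, ℂ)) (_ : x ∈ classW p φ) (y : Lp ℂ p (volume : Measure (E d)))
    (_ : lqNorm p (F x - (y : 𝓢'(E d, ℂ))) ≤ ENNReal.ofReal δ),
    lqNorm 2 (multOp ψ x - (m y : 𝓢'(E d, ℂ)))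

/-- The error of optimal recovery. -/
def optimalError {d n : ℕ} (p : ℝ≥0∞) [Fact (1 ≤ p)] (ψ : E d → ℂ) (φ : Fin n → E d → ℂ)
    (δ : ℝ) : ℝ≥0∞ :=
  ⨅ m : Method d p, methodError p ψ φ δ m

/-! ### Fractional derivatives -/

/-- The function `(iξ)^α = (iξ₁)^{α₁} ⋯ (iξ_d)^{α_d}` (principal values). -/
def iPow {d : ℕ} (α : Fin d → ℝ) (ξ : E d) : ℂ :=
  ∏ k, (Complex.I * (ξ k : ℂ)) ^ (α k : ℂ)

/-- The symbols `(iξ)^{ν e_j}` of the operators `D^{ν e_j}`, `j = 1, …, d`. -/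
def derivSymbol (d : ℕ) (ν : ℝ) (j : Fin d) : E d → ℂ :=
  iPow (Pi.single j ν)

/-! ### Constants -/

/-- `γ̃ = (ν - η) / (ν + d (1/2 - 1/p))`. -/
def gammaT (d : ℕ) (p : ℝ≥0∞) (ν η : ℝ) : ℝ :=
  (ν - η) / (ν + d * (1 / 2 - (p⁻¹).toReal))

/-- `q̃ = 1 / (γ̃ (1/2 - 1/p))`. -/
def qT (d : ℕ) (p : ℝ≥0∞) (ν η : ℝ) : ℝ :=
  1 / (gammaT d p ν η * (1 / 2 - (p⁻¹).toReal))

/-- `C_p(ν, η)` for `n` operators `D_1, …, D_n` on `ℝᵈ`. -/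
def constC (d n : ℕ) (p : ℝ≥0∞) (ν η : ℝ) : ℝ :=
  gammaT d p ν η ^ (-(gammaT d p ν η * (p⁻¹).toReal)) *
    ((1 - gammaT d p ν η) / n) ^ (-((1 - gammaT d p ν η) / 2)) *
    (ProbabilityTheory.beta (qT d p ν η * gammaT d p ν η * (p⁻¹).toReal + 1)
      (qT d p ν η * (1 - gammaT d p ν η) / 2) / (2 * |ν - η|)) ^ (1 / qT d p ν η)

/-- The integrand of `I`, as a function on the unit sphere. -/
def integrandI {d : ℕ} (p : ℝ≥0∞) (ν η : ℝ) (ψ : E d → ℂ)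
    (ω : Metric.sphere (0 : E d) 1) : ℝ :=
  ‖ψ ω‖ ^ qT d p ν η /
    (∑ k, |(ω : E d) k| ^ (2 * ν)) ^ (qT d p ν η * (1 - gammaT d p ν η) / 2)

/-- `I`, the integral over the unit sphere with respect to the surface measure
(in spherical coordinates this measure is `J(ω) dω`). -/
def constI {d : ℕ} (p : ℝ≥0∞) (ν η : ℝ) (ψ : E d → ℂ) : ℝ :=
  ∫ ω, integrandI p ν η ψ ω ∂(volume : Measure (E d)).toSphere

/-- `(2π)^{-dγ̃/2} C_p(ν, η) I^{1/q̃}`. -/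
def constK {d : ℕ} (p : ℝ≥0∞) (ν η : ℝ) (ψ : E d → ℂ) : ℝ :=
  1 / (2 * Real.pi) ^ (d * gammaT d p ν η / 2) * constC d d p ν η *
    constI p ν η ψ ^ (1 / qT d p ν η)

/-- The parameter `β` of the optimal filter. -/
def constBeta {d : ℕ} (p : ℝ≥0∞) (ν η δ : ℝ) (ψ : E d → ℂ) : ℝ :=
  (1 - gammaT d p ν η) / (d * (2 * Real.pi) ^ (d * gammaT d p ν η)) *
    constC d d p ν η ^ 2 *
    (δ * constI p ν η ψ ^ (1 / 2 - (p⁻¹).toReal)) ^ (2 * gammaT d p ν η)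

/-- The filter `(1 - β ∑ |ξ_j|^{2ν} / |ψ(ξ)|²)₊ ψ(ξ)`. -/
def filter {d : ℕ} (p : ℝ≥0∞) (ν η δ : ℝ) (ψ : E d → ℂ) (ξ : E d) : ℂ :=
  ((max (1 - constBeta p ν η δ ψ * (∑ j, |ξ j| ^ (2 * ν)) / ‖ψ ξ‖ ^ 2) 0 : ℝ) : ℂ) * ψ ξ

end

end OptRecovery

open OptRecovery

/-! Write f = Fx, S = ∑ |ξ_j|^{2ν}, θ = 1/2 - 1/p, γ = γ̃, and let r = 1/(2θ) be the exponent
conjugate to p/2. By Plancherel the extremal problem is to bound ‖ψf‖₂ under ‖f‖_p ≤ δ and ‖|ξ_j|^ν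
f‖₂ ≤ (2π)^{d/2}.

Upper bound. For every β > 0, |ψ|² ≤ βS + (|ψ|² - βS)₊. Integrating against |f|² and applying Hölder
to the last term gives ‖ψf‖₂² ≤ β ∑ ‖|ξ_j|^ν f‖₂² + J(β)^{2θ} ‖f‖_p² with J(β) = ∫ (|ψ|² - βS)₊^r
(`eLpNorm_sq_le`). By homogeneity, spherical coordinates turn J into a beta integral times I, so J
is a constant times a negative power of β. The β of the theorem minimises the resulting bound, and
(2π)^{-d} times the minimum is (Kδ^γ)² (`truncIntegral_constBeta`, `constBeta_mul_eq_sq`). The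
filter splits ψ pointwise in the same proportion, so its error obeys the same estimate
(`norm_sub_filter_mul_sq_le`).

Lower bound. Equality holds throughout for f = A (|ψ|² - βS)₊^{r/p}, with A chosen so that ‖f‖_p =
δ. Then ∫ S f² = d (2π)^d, and the symmetry of ψ distributes this equally over the coordinates, so f
is admissible (`exists_extremal`). Both x and -x are compatible with the data y = 0, so no method
does better (`le_optimalError`).

The sharp inequality is the same estimate with δ replaced by the ratio of the two norms; the
extremal function for δ = 1 shows that K is least. -/

namespace OptRecovery

/-! ### Truncated powers and beta integrals -/

/-- The truncated power `x₊ᵐ`, with value `0` for `x ≤ 0` also when `m = 0`. -/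
noncomputable def truncPow (m x : ℝ) : ℝ := if 0 < x then x ^ m else 0

lemma truncPow_of_pos {m x : ℝ} (hx : 0 < x) : truncPow m x = x ^ m := if_pos hx

lemma truncPow_of_nonpos {m x : ℝ} (hx : x ≤ 0) : truncPow m x = 0 := if_neg hx.not_gt

lemma truncPow_nonneg (m x : ℝ) : 0 ≤ truncPow m x := by
  unfold truncPow
  split_ifs with h
  · positivity
  · rfl

lemma truncPow_mul {m c x : ℝ} (hc : 0 < c) : truncPow m (c * x) = c ^ m * truncPow m x := by
  rcases lt_or_ge 0 x with hx | hx
  · rw [truncPow_of_pos hx, truncPow_of_pos (by positivity), Real.mul_rpow hc.le hx.le]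
  · rw [truncPow_of_nonpos hx, truncPow_of_nonpos (mul_nonpos_of_nonneg_of_nonpos hc.le hx),
      mul_zero]

lemma truncPow_mul_truncPow (m n x : ℝ) :
    truncPow m x * truncPow n x = truncPow (m + n) x := by
  rcases lt_or_ge 0 x with hx | hx
  · simp only [truncPow_of_pos hx, Real.rpow_add hx]
  · simp [truncPow_of_nonpos hx]

lemma truncPow_rpow {m n x : ℝ} (hn : n ≠ 0) :
    truncPow m x ^ n = truncPow (m * n) x := by
  rcases lt_or_ge 0 x with hx | hx
  · simp only [truncPow_of_pos hx, Real.rpow_mul hx.le]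
  · simp [truncPow_of_nonpos hx, hn]

@[fun_prop]
lemma measurable_truncPow (m : ℝ) : Measurable (truncPow m) :=
  Measurable.ite measurableSet_Ioi (by fun_prop) measurable_const

/-- On (0, 1) the integrand is B(a, m) times the density of the beta distribution, which has total
mass 1; beyond 1 both vanish. -/
lemma lintegral_rpow_mul_truncPow {a m : ℝ} (ha : 0 < a) (hm : 0 < m) :
    ∫⁻ w in Set.Ioi (0 : ℝ), ENNReal.ofReal (w ^ (a - 1) * truncPow (m - 1) (1 - w)) =
      ENNReal.ofReal (ProbabilityTheory.beta a m) := by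
  have hB := ProbabilityTheory.beta_pos ha hm
  have key : ∀ w ∈ Set.Ioi (0 : ℝ),
      ENNReal.ofReal (w ^ (a - 1) * truncPow (m - 1) (1 - w)) =
      ENNReal.ofReal (ProbabilityTheory.beta a m) * ProbabilityTheory.betaPDF a m w := by
    intro w hw
    rcases lt_or_ge w 1 with h1 | h1
    · rw [ProbabilityTheory.betaPDF_of_pos_lt_one hw h1, ← ENNReal.ofReal_mul hB.le,
        truncPow_of_pos (by linarith)]
      congr 1
      field_simp
    · rw [ProbabilityTheory.betaPDF_eq_zero_of_one_le h1, truncPow_of_nonpos (by linarith)]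
      simp
  rw [setLIntegral_congr_fun measurableSet_Ioi key, lintegral_const_mul' _ _ ENNReal.ofReal_ne_top]
  have h1 : ∫⁻ w in Set.Ioi (0 : ℝ), ProbabilityTheory.betaPDF a m w = 1 := by
    rw [← ProbabilityTheory.lintegral_betaPDF_eq_one ha hm, setLIntegral_eq_of_support_subset]
    intro w hw
    by_contra h
    exact hw (ProbabilityTheory.betaPDF_eq_zero_of_nonpos (not_lt.1 h))
  rw [h1, mul_one]

/-- Substitution w = cρ^k in the beta integral. -/
lemma lintegral_rpow_mul_truncPow_comp {a m c k : ℝ} (ha : 0 < a) (hm : 0 < m) (hc : 0 < c)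
    (hk : 0 < k) :
    ∫⁻ ρ in Set.Ioi (0 : ℝ), ENNReal.ofReal (ρ ^ (k * a - 1) * truncPow (m - 1) (1 - c * ρ ^ k)) =
      ENNReal.ofReal (c ^ (-a) / k * ProbabilityTheory.beta a m) := by
  have himg : (fun ρ : ℝ => c * ρ ^ k) '' Set.Ioi 0 = Set.Ioi 0 := by
    ext w
    constructor
    · rintro ⟨ρ, hρ, rfl⟩
      have : 0 < ρ := hρ
      simp only [Set.mem_Ioi]
      positivity
    · intro hw
      have hw : 0 < w := hw
      refine ⟨(w / c) ^ k⁻¹, Real.rpow_pos_of_pos (by positivity) _, ?_⟩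
      simp only
      rw [Real.rpow_inv_rpow (by positivity) hk.ne']
      field_simp
  have hinj : Set.InjOn (fun ρ : ℝ => c * ρ ^ k) (Set.Ioi 0) := by
    intro x hx y hy hxy
    exact (Real.rpow_left_inj (le_of_lt hx) (le_of_lt hy) hk.ne').1 (mul_left_cancel₀ hc.ne' hxy)
  have h := lintegral_image_eq_lintegral_abs_deriv_mul (s := Set.Ioi (0 : ℝ)) measurableSet_Ioi
    (f := fun ρ => c * ρ ^ k) (f' := fun ρ => c * (k * ρ ^ (k - 1)))
    (fun x hx => ((Real.hasDerivAt_rpow_const (Or.inl (ne_of_gt hx))).const_mul c).hasDerivWithinAt)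
    hinj (fun w => ENNReal.ofReal (w ^ (a - 1) * truncPow (m - 1) (1 - w)))
  rw [himg, lintegral_rpow_mul_truncPow ha hm] at h
  have hca : 0 < k * c ^ a := by positivity
  have h2 : ∀ ρ ∈ Set.Ioi (0 : ℝ),
      ENNReal.ofReal |c * (k * ρ ^ (k - 1))| *
        ENNReal.ofReal ((c * ρ ^ k) ^ (a - 1) * truncPow (m - 1) (1 - c * ρ ^ k)) =
      ENNReal.ofReal (k * c ^ a) *
        ENNReal.ofReal (ρ ^ (k * a - 1) * truncPow (m - 1) (1 - c * ρ ^ k)) := by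
    intro ρ hρ
    have hρ : 0 < ρ := hρ
    rw [← ENNReal.ofReal_mul (abs_nonneg _), ← ENNReal.ofReal_mul hca.le,
      abs_of_pos (by positivity), Real.mul_rpow hc.le (by positivity), ← Real.rpow_mul hρ.le]
    congr 1
    have e1 : ρ ^ (k - 1) * ρ ^ (k * (a - 1)) = ρ ^ (k * a - 1) := by
      rw [← Real.rpow_add hρ]; ring_nf
    have e2 : c * c ^ (a - 1) = c ^ a := by
      rw [Real.rpow_sub_one hc.ne']; field_simp
    rw [← e1, ← e2]
    ring
  rw [setLIntegral_congr_fun measurableSet_Ioi h2,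
    lintegral_const_mul' _ _ ENNReal.ofReal_ne_top] at h
  have h3 : c ^ (-a) / k * ProbabilityTheory.beta a m =
      (k * c ^ a)⁻¹ * ProbabilityTheory.beta a m := by
    rw [Real.rpow_neg hc.le]; field_simp
  rw [h3, ENNReal.ofReal_mul (by positivity), h, ← mul_assoc, ← ENNReal.ofReal_mul (by positivity),
    inv_mul_cancel₀ hca.ne', ENNReal.ofReal_one, one_mul]

/-! ### Spherical coordinates and homogeneous integrands -/

/-- Integration in spherical coordinates. -/
lemma lintegral_eq_lintegral_sphere {V : Type*} [NormedAddCommGroup V] [NormedSpace ℝ V]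
    [MeasurableSpace V] [BorelSpace V] [FiniteDimensional ℝ V] [Nontrivial V]
    (μ : Measure V) [μ.IsAddHaarMeasure] {f : V → ℝ≥0∞} (hf : Measurable f) :
    ∫⁻ ξ, f ξ ∂μ = ∫⁻ ω : Metric.sphere (0 : V) 1, (∫⁻ ρ in Set.Ioi (0 : ℝ),
      ENNReal.ofReal (ρ ^ (Module.finrank ℝ V - 1)) * f (ρ • (ω : V))) ∂μ.toSphere := by
  have hm : Measurable fun x : Metric.sphere (0 : V) 1 × Set.Ioi (0 : ℝ) =>
      f ((x.2 : ℝ) • (x.1 : V)) := by fun_prop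
  calc
    ∫⁻ ξ, f ξ ∂μ = ∫⁻ ξ : ({(0)}ᶜ : Set V), f ξ ∂(μ.comap (↑)) := by
      rw [lintegral_subtype_comap (measurableSet_singleton _).compl, restrict_compl_singleton]
    _ = ∫⁻ x : Metric.sphere (0 : V) 1 × Set.Ioi (0 : ℝ), f ((x.2 : ℝ) • (x.1 : V))
          ∂μ.toSphere.prod (.volumeIoiPow (Module.finrank ℝ V - 1)) := by
      rw [← μ.measurePreserving_homeomorphUnitSphereProd.lintegral_comp hm]
      refine lintegral_congr fun ξ => ?_
      congr 1
      have : (ξ : V) ≠ 0 := ξ.2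
      simp [smul_smul, this]
    _ = _ := by
      rw [lintegral_prod _ hm.aemeasurable]
      refine lintegral_congr fun ω => ?_
      rw [Measure.volumeIoiPow, lintegral_withDensity_eq_lintegral_mul _ (by fun_prop) (by fun_prop)]
      exact lintegral_subtype_comap measurableSet_Ioi
        (fun ρ : ℝ => ENNReal.ofReal (ρ ^ (Module.finrank ℝ V - 1)) * f (ρ • (ω : V)))

/-- The integral along a ray of a homogeneous weight times a truncated power. -/
lemma lintegral_ray {n : ℕ} {P s β e m a η ν : ℝ} (hP : 0 ≤ P) (hs : 0 < s) (hβ : 0 < β)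
    (hm : 0 < m) (ha : 0 < a) (hην : η < ν) (ham : 0 < a + (m - 1))
    (h : 2 * (ν - η) * a = 2 * ν * e + 2 * η * (m - 1) + (n + 1)) :
    ∫⁻ ρ in Set.Ioi (0 : ℝ), ENNReal.ofReal (ρ ^ n) *
      ENNReal.ofReal ((ρ ^ (2 * ν) * s) ^ e *
        truncPow (m - 1) (ρ ^ (2 * η) * P - β * (ρ ^ (2 * ν) * s))) =
    ENNReal.ofReal (β ^ (-a) * (ProbabilityTheory.beta a m / (2 * (ν - η))) *
      (P ^ (a + (m - 1)) * s ^ (e - a))) := by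
  have hk : 0 < 2 * (ν - η) := by linarith
  -- If P = 0 the truncated power vanishes on the whole ray, and the right side vanishes because a +
  -- (m - 1) > 0.
  rcases hP.eq_or_lt with rfl | hP
  · have h0 : ∀ ρ ∈ Set.Ioi (0 : ℝ), ENNReal.ofReal (ρ ^ n) *
        ENNReal.ofReal ((ρ ^ (2 * ν) * s) ^ e *
          truncPow (m - 1) (ρ ^ (2 * η) * 0 - β * (ρ ^ (2 * ν) * s))) = 0 := by
      intro ρ hρ
      have hρ : 0 < ρ := hρ
      rw [truncPow_of_nonpos]
      · simp
      · have : 0 < β * (ρ ^ (2 * ν) * s) := by positivity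
        linarith
    rw [setLIntegral_congr_fun measurableSet_Ioi h0, Real.zero_rpow ham.ne']
    simp
  -- Pulling out ρ^{2η}P leaves 1 - cρ^{2(ν-η)}. The hypothesis `h` says that the remaining powers
  -- of ρ combine to the exponent 2(ν-η)a - 1 of the beta integral.
  · set c := β * s / P with hc
    have hcpos : 0 < c := by positivity
    have h1 : ∀ ρ ∈ Set.Ioi (0 : ℝ), ENNReal.ofReal (ρ ^ n) *
        ENNReal.ofReal ((ρ ^ (2 * ν) * s) ^ e *
          truncPow (m - 1) (ρ ^ (2 * η) * P - β * (ρ ^ (2 * ν) * s))) =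
        ENNReal.ofReal (s ^ e * P ^ (m - 1)) * ENNReal.ofReal
          (ρ ^ (2 * (ν - η) * a - 1) * truncPow (m - 1) (1 - c * ρ ^ (2 * (ν - η)))) := by
      intro ρ hρ
      have hρ : 0 < ρ := hρ
      have e1 : ρ ^ (2 * η) * P - β * (ρ ^ (2 * ν) * s) =
          (ρ ^ (2 * η) * P) * (1 - c * ρ ^ (2 * (ν - η))) := by
        have : ρ ^ (2 * ν) = ρ ^ (2 * η) * ρ ^ (2 * (ν - η)) := by
          rw [← Real.rpow_add hρ]; ring_nf
        rw [this, hc]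
        field_simp
      rw [e1, truncPow_mul (by positivity), ← ENNReal.ofReal_mul (by positivity),
        ← ENNReal.ofReal_mul (by positivity), Real.mul_rpow (by positivity) hs.le,
        Real.mul_rpow (by positivity) hP.le, ← Real.rpow_mul hρ.le, ← Real.rpow_mul hρ.le]
      congr 1
      have e2 : ρ ^ (2 * (ν - η) * a - 1) = ρ ^ n * ρ ^ (2 * ν * e) * ρ ^ (2 * η * (m - 1)) := by
        rw [← Real.rpow_natCast, ← Real.rpow_add hρ, ← Real.rpow_add hρ, h]
        ring_nf
      rw [e2]
      ring
    rw [setLIntegral_congr_fun measurableSet_Ioi h1,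
      lintegral_const_mul' _ _ ENNReal.ofReal_ne_top,
      lintegral_rpow_mul_truncPow_comp ha hm hcpos hk, ← ENNReal.ofReal_mul (by positivity)]
    congr 1
    have e3 : c ^ (-a) = β ^ (-a) * s ^ (-a) * P ^ a := by
      rw [hc, Real.div_rpow (by positivity) hP.le, Real.mul_rpow hβ.le hs.le, Real.rpow_neg hP.le]
      field_simp
    rw [e3, Real.rpow_add hP, sub_eq_add_neg e a, Real.rpow_add hs]
    ring

/-- The symbol `∑ |ξ_j|^{2ν}`. -/
noncomputable def powSum {d : ℕ} (ν : ℝ) (ξ : E d) : ℝ := ∑ j, |ξ j| ^ (2 * ν)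

section Homogeneous

variable {d : ℕ} {ν η : ℝ} {ψ : E d → ℂ}

lemma powSum_nonneg (ξ : E d) : 0 ≤ powSum ν ξ :=
  Finset.sum_nonneg fun _ _ => by positivity

lemma powSum_smul {t : ℝ} (ht : 0 < t) (ξ : E d) :
    powSum ν (t • ξ) = t ^ (2 * ν) * powSum ν ξ := by
  simp only [powSum, Finset.mul_sum]
  refine Finset.sum_congr rfl fun j _ => ?_
  rw [PiLp.smul_apply, smul_eq_mul, abs_mul, abs_of_pos ht, Real.mul_rpow ht.le (abs_nonneg _)]

lemma powSum_pos {ξ : E d} (hξ : ξ ≠ 0) : 0 < powSum ν ξ := by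
  obtain ⟨j, hj⟩ : ∃ j, ξ j ≠ 0 := by
    by_contra! h
    exact hξ (PiLp.ext h)
  exact Finset.sum_pos' (fun _ _ => by positivity)
    ⟨j, Finset.mem_univ _, Real.rpow_pos_of_pos (abs_pos.2 hj) _⟩

lemma continuous_powSum (hν : 0 ≤ ν) : Continuous (powSum ν : E d → ℝ) := by
  unfold powSum
  refine continuous_finsetSum _ fun j _ => ?_
  exact Continuous.rpow_const (by fun_prop) fun _ => Or.inr (by positivity)

/-- Although ψ is only a.e. measurable, |ψ(ξ)| = ‖ξ‖^η |ψ(ξ/‖ξ‖)| is continuous away from 0. -/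
lemma measurable_norm_of_homogeneous (hhom : ∀ t : ℝ, 0 < t → ∀ ξ : E d,
      ‖ψ (t • ξ)‖ = t ^ η * ‖ψ ξ‖)
    (hcont : Continuous fun ω : Metric.sphere (0 : E d) 1 => ‖ψ ω‖) :
    Measurable fun ξ => ‖ψ ξ‖ := by
  refine measurable_of_continuousOn_compl_singleton 0 ?_
  rw [continuousOn_iff_continuous_domRestrict]
  have h : ∀ ξ : ({0}ᶜ : Set (E d)), ‖ψ ξ‖ =
      ‖(ξ : E d)‖ ^ η * ‖ψ ((homeomorphUnitSphereProd (E d) ξ).1)‖ := by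
    intro ξ
    have hξ : 0 < ‖(ξ : E d)‖ := norm_pos_iff.2 ξ.2
    rw [← hhom _ hξ, homeomorphUnitSphereProd_apply_fst_coe, smul_smul, mul_inv_cancel₀ hξ.ne',
      one_smul]
  refine Continuous.congr ?_ fun ξ => (h ξ).symm
  refine Continuous.mul ?_ (hcont.comp ?_)
  · exact Continuous.rpow_const (by fun_prop) fun ξ => Or.inl (norm_ne_zero_iff.2 ξ.2)
  · exact continuous_fst.comp (homeomorphUnitSphereProd (E d)).continuous

/-- Each ray contributes a constant times a function of its direction, by `lintegral_ray` with n = d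
- 1. The cases e = 0 and e = 1 give the two integrals needed later. -/
lemma lintegral_powSum_mul_truncPow [Nontrivial (E d)] (hd : 0 < d) (hν : 0 ≤ ν)
    (hhom : ∀ t : ℝ, 0 < t → ∀ ξ : E d, ‖ψ (t • ξ)‖ = t ^ η * ‖ψ ξ‖)
    (hcont : Continuous fun ω : Metric.sphere (0 : E d) 1 => ‖ψ ω‖) {β e m a : ℝ} (hβ : 0 < β)
    (hm : 0 < m) (ha : 0 < a) (hην : η < ν) (ham : 0 < a + (m - 1))
    (h : 2 * (ν - η) * a = 2 * ν * e + 2 * η * (m - 1) + d) :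
    ∫⁻ ξ : E d, ENNReal.ofReal (powSum ν ξ ^ e *
        truncPow (m - 1) (‖ψ ξ‖ ^ 2 - β * powSum ν ξ)) =
      ENNReal.ofReal (β ^ (-a) * (ProbabilityTheory.beta a m / (2 * (ν - η)))) *
        ∫⁻ ω : Metric.sphere (0 : E d) 1, ENNReal.ofReal
          (‖ψ ω‖ ^ (2 * (a + (m - 1))) * powSum ν (ω : E d) ^ (e - a))
          ∂(volume : Measure (E d)).toSphere := by
  have hψm := measurable_norm_of_homogeneous hhom hcont
  have hSm : Measurable (powSum ν : E d → ℝ) := (continuous_powSum hν).measurable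
  have hB := ProbabilityTheory.beta_pos ha hm
  have hk : 0 < 2 * (ν - η) := by linarith
  rw [lintegral_eq_lintegral_sphere volume
    (by fun_prop (disch := assumption)), ← lintegral_const_mul' _ _ ENNReal.ofReal_ne_top]
  refine lintegral_congr fun ω => ?_
  have hω : (ω : E d) ≠ 0 := ne_zero_of_mem_unit_sphere ω
  rw [← ENNReal.ofReal_mul (by positivity), Real.rpow_mul (norm_nonneg _), Real.rpow_two,
    ← lintegral_ray (n := d - 1) (sq_nonneg _) (powSum_pos hω) hβ hm ha hην ham]
  · refine setLIntegral_congr_fun measurableSet_Ioi fun ρ hρ => ?_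
    have hρ : 0 < ρ := hρ
    simp only [finrank_euclideanSpace, Fintype.card_fin]
    rw [powSum_smul hρ, hhom ρ hρ, mul_pow, ← Real.rpow_mul_natCast hρ.le, Nat.cast_ofNat,
      mul_comm η 2]
  · rw [h, Nat.cast_sub hd]
    simp

end Homogeneous

/-! ### Regular distributions and Plancherel's theorem -/

section Distributions

variable {d : ℕ}

lemma toTemperedDistribution_injective {q : ℝ≥0∞} [Fact (1 ≤ q)] {f g : Lp ℂ q (volume : Measure (E d))}
    (h : (f : 𝓢'(E d, ℂ)) = (g : 𝓢'(E d, ℂ))) : f = g :=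
  LinearMap.ker_eq_bot.1
    (Lp.ker_toTemperedDistributionCLM_eq_bot (E := E d) (F := ℂ) (μ := volume) (p := q)) h

lemma toTemperedDistribution_sub {q : ℝ≥0∞} [Fact (1 ≤ q)] (f g : Lp ℂ q (volume : Measure (E d))) :
    ((f - g : Lp ℂ q (volume : Measure (E d))) : 𝓢'(E d, ℂ)) =
      (f : 𝓢'(E d, ℂ)) - (g : 𝓢'(E d, ℂ)) :=
  map_sub (Lp.toTemperedDistributionCLM ℂ volume q) f g

lemma toTemperedDistribution_neg {q : ℝ≥0∞} [Fact (1 ≤ q)] (f : Lp ℂ q (volume : Measure (E d))) :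
    ((-f : Lp ℂ q (volume : Measure (E d))) : 𝓢'(E d, ℂ)) = -(f : 𝓢'(E d, ℂ)) :=
  map_neg (Lp.toTemperedDistributionCLM ℂ volume q) f

/-- An element of L_q is determined by its distribution, so the infimum runs over a single element.
-/
lemma lqNorm_toTemperedDistribution {q : ℝ≥0∞} [Fact (1 ≤ q)] (f : Lp ℂ q (volume : Measure (E d))) :
    lqNorm q (f : 𝓢'(E d, ℂ)) = ‖f‖ₑ := by
  refine le_antisymm ?_ (le_iInf₂ fun g hg => ?_)
  · unfold lqNorm
    exact (iInf_le _ f).trans (iInf_le _ rfl)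
  rw [toTemperedDistribution_injective hg]

lemma isDensity_toTemperedDistribution {q : ℝ≥0∞} [hq : Fact (1 ≤ q)]
    (f : Lp ℂ q (volume : Measure (E d))) : IsDensity (f : 𝓢'(E d, ℂ)) f := by
  refine ⟨Lp.aestronglyMeasurable f, fun s => ⟨?_, ?_⟩⟩
  · have : ENNReal.HolderConjugate q (1 - q⁻¹)⁻¹ := ENNReal.HolderConjugate.inv_one_sub_inv' hq.out
    have h := (Lp.memLp f).integrable_mul (s.memLp (1 - q⁻¹)⁻¹ volume)
    refine h.congr (Filter.Eventually.of_forall fun ξ => ?_)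
    simp [mul_comm]
  · simp

lemma IsDensity.congr_ae {u : 𝓢'(E d, ℂ)} {f g : E d → ℂ} (h : IsDensity u f)
    (hfg : f =ᵐ[volume] g) : IsDensity u g := by
  refine ⟨h.1.congr hfg, fun s => ?_⟩
  have hs : (fun ξ => s ξ * f ξ) =ᵐ[volume] fun ξ => s ξ * g ξ := by
    filter_upwards [hfg] with ξ hξ
    rw [hξ]
  exact ⟨(h.2 s).1.congr hs, (h.2 s).2.trans (integral_congr_ae hs)⟩

lemma IsDensity.eq_dist {u v : 𝓢'(E d, ℂ)} {f : E d → ℂ} (hu : IsDensity u f)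
    (hv : IsDensity v f) : u = v := by
  ext s
  rw [(hu.2 s).2, (hv.2 s).2]

lemma funcDist_eq {u : 𝓢'(E d, ℂ)} {f : E d → ℂ} (h : IsDensity u f) : funcDist f = u := by
  have hex : ∃ u : 𝓢'(E d, ℂ), IsDensity u f := ⟨u, h⟩
  rw [funcDist, dif_pos hex]
  exact hex.choose_spec.eq_dist h

lemma funcDist_eq_toLp {q : ℝ≥0∞} [Fact (1 ≤ q)] {f : E d → ℂ} (hf : MemLp f q volume) :
    funcDist f = ((hf.toLp f : Lp ℂ q (volume : Measure (E d))) : 𝓢'(E d, ℂ)) :=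
  funcDist_eq ((isDensity_toTemperedDistribution _).congr_ae hf.coeFn_toLp)

/-- Testing against a bump function equal to 1 on a ball gives integrability on that ball. -/
lemma IsDensity.locallyIntegrable {u : 𝓢'(E d, ℂ)} {f : E d → ℂ} (h : IsDensity u f) :
    LocallyIntegrable f volume := by
  intro x
  let φ : ContDiffBump x := ⟨1, 2, one_pos, one_lt_two⟩
  have h1 : HasCompactSupport (Complex.ofRealCLM ∘ φ) := φ.hasCompactSupport.comp_left rfl
  have h2 : ContDiff ℝ ((⊤ : ℕ∞) : WithTop ℕ∞) (Complex.ofRealCLM ∘ φ) :=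
    Complex.ofRealCLM.contDiff.comp φ.contDiff
  refine ⟨Metric.closedBall x 1, Metric.closedBall_mem_nhds x one_pos, ?_⟩
  refine ((h.2 (h1.toSchwartzMap h2)).1.integrableOn (s := Metric.closedBall x 1)).congr_fun
    (fun ξ hξ => ?_) Metric.isClosed_closedBall.measurableSet
  simp [φ.one_of_mem_closedBall hξ]

lemma IsDensity.ae_eq {u : 𝓢'(E d, ℂ)} {f g : E d → ℂ} (hf : IsDensity u f)
    (hg : IsDensity u g) : f =ᵐ[volume] g := by
  refine ae_eq_of_integral_contDiff_smul_eq hf.locallyIntegrable hg.locallyIntegrable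
    fun φ hφ hφc => ?_
  have h1 : HasCompactSupport (Complex.ofRealCLM ∘ φ) := hφc.comp_left rfl
  have h2 : ContDiff ℝ ((⊤ : ℕ∞) : WithTop ℕ∞) (Complex.ofRealCLM ∘ φ) :=
    Complex.ofRealCLM.contDiff.comp hφ
  have e1 := (hf.2 (h1.toSchwartzMap h2)).2
  rw [(hg.2 (h1.toSchwartzMap h2)).2] at e1
  simpa using e1.symm

lemma density_ae_eq {u : 𝓢'(E d, ℂ)} {f : E d → ℂ} (h : IsDensity u f) :
    density u =ᵐ[volume] f := by
  have hex : ∃ f : E d → ℂ, IsDensity u f := ⟨f, h⟩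
  rw [density, dif_pos hex]
  exact hex.choose_spec.ae_eq h

lemma Finv_toTemperedDistribution_apply (h : Lp ℂ 2 (volume : Measure (E d))) (s : 𝓢(E d, ℂ)) :
    Finv (h : 𝓢'(E d, ℂ)) s =
      ∫ ξ, s ((2 * Real.pi) • ξ) * (𝓕⁻ h : Lp ℂ 2 (volume : Measure (E d))) ξ := by
  have e : Finv (h : 𝓢'(E d, ℂ)) s = (𝓕⁻ (h : 𝓢'(E d, ℂ)))
      (SchwartzMap.compCLMOfContinuousLinearEquiv ℂ (dilation d (2 * Real.pi) two_pi_ne_zero) s) :=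
    rfl
  rw [e, Lp.fourierInv_toTemperedDistribution_eq, Lp.toTemperedDistribution_apply]
  rfl

lemma eLpNorm_comp_smul (f : E d → ℂ) (hf : AEStronglyMeasurable f volume) {c : ℝ} (hc : 0 < c) :
    eLpNorm (fun ξ => f (c • ξ)) 2 volume =
      ENNReal.ofReal ((c ^ d)⁻¹ ^ (1 / 2 : ℝ)) * eLpNorm f 2 volume := by
  have hmap := Measure.map_addHaar_smul (volume : Measure (E d)) hc.ne'
  have hf' : AEStronglyMeasurable f (Measure.map (c • ·) (volume : Measure (E d))) := by
    rw [hmap]; exact hf.smul_measure _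
  have h := eLpNorm_map_measure (p := 2) hf' (measurable_const_smul c).aemeasurable
  rw [hmap, eLpNorm_smul_measure_of_ne_top (by norm_num)] at h
  rw [show (fun ξ => f (c • ξ)) = f ∘ (c • ·) from rfl, ← h]
  rw [abs_of_pos (by positivity), ENNReal.ofReal_rpow_of_pos (by positivity)]
  simp

/-- Plancherel's theorem for `F⁻¹`. -/
lemma exists_toTemperedDistribution_eq_Finv (h : Lp ℂ 2 (volume : Measure (E d))) :
    ∃ g : Lp ℂ 2 (volume : Measure (E d)), (g : 𝓢'(E d, ℂ)) = Finv (h : 𝓢'(E d, ℂ)) ∧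
      ‖g‖ₑ = ENNReal.ofReal ((2 * Real.pi) ^ (-(d / 2 : ℝ))) * ‖h‖ₑ := by
  set k : Lp ℂ 2 (volume : Measure (E d)) := 𝓕⁻ h
  set c : ℝ := (2 * Real.pi)⁻¹
  have hc : 0 < c := by positivity
  have hk : ‖k‖ₑ = ‖h‖ₑ := by
    have : ‖k‖ = ‖h‖ := (Lp.fourierTransformₗᵢ (E d) ℂ).symm.norm_map h
    rw [← ofReal_norm, this, ofReal_norm]
  have hnorm := eLpNorm_comp_smul k (Lp.aestronglyMeasurable k) hc
  have hmeas : AEStronglyMeasurable (fun ξ => k (c • ξ)) volume := by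
    refine AEStronglyMeasurable.comp_aemeasurable ?_ (measurable_const_smul c).aemeasurable
    rw [Measure.map_addHaar_smul _ hc.ne']
    exact (Lp.aestronglyMeasurable k).smul_measure _
  have hmem : MemLp (fun ξ => k (c • ξ)) 2 volume :=
    ⟨hmeas, by rw [hnorm]; exact ENNReal.mul_lt_top ENNReal.ofReal_lt_top (Lp.memLp k).2⟩
  -- The dilation in F⁻¹ moves from the test function to k = 𝓕⁻h and brings the Jacobian c^d. The
  -- norm is then c^d · c^{-d/2} ‖h‖ = (2π)^{-d/2} ‖h‖.
  refine ⟨((c : ℂ) ^ d) • hmem.toLp _, ?_, ?_⟩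
  · ext s
    rw [Finv_toTemperedDistribution_apply, Lp.toTemperedDistribution_apply]
    have e1 : ∫ ξ, s ξ • (((c : ℂ) ^ d) • hmem.toLp _ : Lp ℂ 2 (volume : Measure (E d))) ξ =
        ∫ ξ, (fun ζ => ((c : ℂ) ^ d) * (s ((2 * Real.pi) • ζ) * k ζ)) (c • ξ) := by
      refine integral_congr_ae ?_
      filter_upwards [Lp.coeFn_smul ((c : ℂ) ^ d) (hmem.toLp _), hmem.coeFn_toLp] with ξ h1 h2
      rw [h1, Pi.smul_apply, h2]
      simp only [c]
      rw [smul_inv_smul₀ two_pi_ne_zero]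
      simp only [smul_eq_mul]
      ring
    rw [e1, Measure.integral_comp_smul volume
      (fun ζ => ((c : ℂ) ^ d) * (s ((2 * Real.pi) • ζ) * k ζ)) c, integral_const_mul]
    simp only [finrank_euclideanSpace, Fintype.card_fin, abs_of_pos (inv_pos.2 (pow_pos hc d))]
    rw [Complex.real_smul, ← mul_assoc]
    push_cast
    rw [inv_mul_cancel₀, one_mul]
    exact pow_ne_zero _ (by exact_mod_cast hc.ne')
  · rw [enorm_smul, Lp.enorm_toLp, hnorm, ← Lp.enorm_def, hk, ← mul_assoc, ← ofReal_norm,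
      ← ENNReal.ofReal_mul (norm_nonneg _)]
    congr 2
    rw [norm_pow, Complex.norm_real, Real.norm_of_nonneg hc.le, ← Real.rpow_natCast,
      ← Real.rpow_neg hc.le, ← Real.rpow_mul hc.le, ← Real.rpow_add hc,
      Real.inv_rpow (by positivity), ← Real.rpow_neg (by positivity)]
    ring_nf

lemma lqNorm_Finv_toTemperedDistribution (h : Lp ℂ 2 (volume : Measure (E d))) :
    lqNorm 2 (Finv (h : 𝓢'(E d, ℂ))) =
      ENNReal.ofReal ((2 * Real.pi) ^ (-(d / 2 : ℝ))) * ‖h‖ₑ := by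
  obtain ⟨g, hg, hn⟩ := exists_toTemperedDistribution_eq_Finv h
  rw [← hg, lqNorm_toTemperedDistribution, hn]

lemma lqNorm_Finv_funcDist {f : E d → ℂ} (hf : MemLp f 2 volume) :
    lqNorm 2 (Finv (funcDist f)) =
      ENNReal.ofReal ((2 * Real.pi) ^ (-(d / 2 : ℝ))) * eLpNorm f 2 volume := by
  rw [funcDist_eq_toLp hf, lqNorm_Finv_toTemperedDistribution, Lp.enorm_toLp]

lemma Finv_sub (x y : 𝓢'(E d, ℂ)) : Finv (x - y) = Finv x - Finv y := rfl

lemma funcDist_sub {f g : E d → ℂ} (hf : MemLp f 2 volume) (hg : MemLp g 2 volume) :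
    funcDist (f - g) = funcDist f - funcDist g := by
  rw [funcDist_eq_toLp hf, funcDist_eq_toLp hg, funcDist_eq_toLp (hf.sub hg), MemLp.toLp_sub,
    toTemperedDistribution_sub]

end Distributions

/-! ### Exponents and constants -/

section Parameters

variable {d : ℕ} {p : ℝ≥0∞} {ν η δ : ℝ} {ψ : E d → ℂ}

/-- The number `1/2 - 1/p`. -/
noncomputable def thetaP (p : ℝ≥0∞) : ℝ := 1 / 2 - (p⁻¹).toReal

lemma thetaP_pos (hp : 2 < p) : 0 < thetaP p := by
  have h : p⁻¹ < 2⁻¹ := ENNReal.inv_lt_inv.2 hp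
  have h2 := (ENNReal.toReal_lt_toReal h.ne_top (by simp)).2 h
  rw [ENNReal.toReal_inv 2] at h2
  rw [thetaP]
  norm_num at h2 ⊢
  linarith

lemma gammaT_eq : gammaT d p ν η = (ν - η) / (ν + d * thetaP p) := rfl

lemma gammaT_pos (hp : 2 < p) (hη : 0 ≤ η) (hην : η < ν) : 0 < gammaT d p ν η := by
  have := thetaP_pos hp
  have : 0 < ν := by linarith
  rw [gammaT_eq]
  exact div_pos (by linarith) (by positivity)

lemma gammaT_lt_one (hd : 0 < d) (hp : 2 < p) (hη : 0 ≤ η) (hην : η < ν) :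
    gammaT d p ν η < 1 := by
  have := thetaP_pos hp
  have hd' : (0 : ℝ) < d := by exact_mod_cast hd
  have : 0 < d * thetaP p := by positivity
  rw [gammaT_eq, div_lt_one (by linarith)]
  linarith

lemma qT_eq : qT d p ν η = 1 / (gammaT d p ν η * thetaP p) := rfl

lemma qT_pos (hp : 2 < p) (hη : 0 ≤ η) (hην : η < ν) : 0 < qT d p ν η := by
  have := thetaP_pos hp
  have := gammaT_pos (d := d) hp hη hην
  rw [qT_eq]
  positivity

/-- The exponent `1 / (1 - 2/p)`, conjugate to `p / 2`. -/
noncomputable def conjExp (p : ℝ≥0∞) : ℝ := (2 * thetaP p)⁻¹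

lemma conjExp_pos (hp : 2 < p) : 0 < conjExp p := by
  have := thetaP_pos hp
  unfold conjExp
  positivity

lemma conjExp_sub_one (hp : 2 < p) : conjExp p - 1 = 2 * (conjExp p * (p⁻¹).toReal) := by
  have h := thetaP_pos hp
  have h2 : (p⁻¹).toReal = 1 / 2 - thetaP p := by unfold thetaP; ring
  rw [h2, conjExp]
  field_simp

lemma qT_mul_gammaT (hp : 2 < p) (hη : 0 ≤ η) (hην : η < ν) :
    qT d p ν η * gammaT d p ν η * (p⁻¹).toReal + 1 = conjExp p := by
  have h := thetaP_pos hp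
  have hγ := gammaT_pos (d := d) hp hη hην
  have h2 : (p⁻¹).toReal = 1 / 2 - thetaP p := by unfold thetaP; ring
  rw [h2, qT_eq, conjExp]
  field_simp
  ring

/-- The second argument of the beta function in `constC`. -/
noncomputable def betaArg (d : ℕ) (p : ℝ≥0∞) (ν η : ℝ) : ℝ :=
  qT d p ν η * (1 - gammaT d p ν η) / 2

lemma betaArg_pos (hd : 0 < d) (hp : 2 < p) (hη : 0 ≤ η) (hην : η < ν) :
    0 < betaArg d p ν η := by
  have := qT_pos (d := d) hp hη hην
  have := gammaT_lt_one hd hp hη hην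
  unfold betaArg
  have : 0 < 1 - gammaT d p ν η := by linarith
  positivity

lemma betaArg_add_conjExp (hp : 2 < p) (hη : 0 ≤ η) (hην : η < ν) :
    2 * (betaArg d p ν η + conjExp p) = qT d p ν η := by
  have h := thetaP_pos hp
  have hγ := gammaT_pos (d := d) hp hη hην
  rw [betaArg, conjExp, qT_eq]
  field_simp
  ring

/-- With r = `conjExp p` and b = `betaArg d p ν η`, this turns the ratios r/(b+r) and b/(b+r) from
the beta recursions into γ and 1 - γ. -/
lemma conjExp_eq_gammaT_mul (hp : 2 < p) (hη : 0 ≤ η) (hην : η < ν) :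
    conjExp p = gammaT d p ν η * (betaArg d p ν η + conjExp p) := by
  have h := thetaP_pos hp
  have hγ := gammaT_pos (d := d) hp hη hην
  rw [betaArg, conjExp, qT_eq]
  field_simp
  ring

/-- This is the balance of powers of ρ along a ray for J; it is where the value of γ̃ enters. -/
lemma betaArg_mul (hp : 2 < p) (hη : 0 ≤ η) (hην : η < ν) :
    2 * (ν - η) * betaArg d p ν η = 2 * η * conjExp p + d := by
  have h := thetaP_pos hp
  have hν : 0 < ν := by linarith
  have hk : ν - η ≠ 0 := by linarith
  have hs : ν + d * thetaP p ≠ 0 := by positivity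
  rw [betaArg, conjExp, qT_eq, gammaT_eq]
  field_simp
  ring

/-- J(β)^{2θ} is thus proportional to β^{1 - 1/γ}. -/
lemma two_thetaP_mul_betaArg (hp : 2 < p) (hη : 0 ≤ η) (hην : η < ν) :
    2 * thetaP p * betaArg d p ν η = 1 / gammaT d p ν η - 1 := by
  have h := thetaP_pos hp
  have hγ := gammaT_pos (d := d) hp hη hην
  rw [betaArg, qT_eq]
  field_simp

lemma beta_add_one_right {a b : ℝ} (ha : 0 < a) (hb : 0 < b) :
    ProbabilityTheory.beta b (a + 1) = a / (b + a) * ProbabilityTheory.beta a b := by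
  have := (Real.Gamma_pos_of_pos (add_pos hb ha)).ne'
  rw [ProbabilityTheory.beta, ProbabilityTheory.beta, Real.Gamma_add_one ha.ne', ← add_assoc,
    Real.Gamma_add_one (by positivity), add_comm a b]
  field_simp

lemma beta_add_one_left {a b : ℝ} (ha : 0 < a) (hb : 0 < b) :
    ProbabilityTheory.beta (b + 1) a = b / (b + a) * ProbabilityTheory.beta a b := by
  have := (Real.Gamma_pos_of_pos (add_pos hb ha)).ne'
  rw [ProbabilityTheory.beta, ProbabilityTheory.beta, Real.Gamma_add_one hb.ne',
    show b + 1 + a = b + a + 1 by ring,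
    Real.Gamma_add_one (by positivity), add_comm a b]
  field_simp

/-- The factor `B / (2 (ν - η))` in `constC`. -/
noncomputable def betaFactor (d : ℕ) (p : ℝ≥0∞) (ν η : ℝ) : ℝ :=
  ProbabilityTheory.beta (conjExp p) (betaArg d p ν η) / (2 * (ν - η))

lemma betaFactor_pos (hd : 0 < d) (hp : 2 < p) (hη : 0 ≤ η) (hην : η < ν) :
    0 < betaFactor d p ν η :=
  div_pos (ProbabilityTheory.beta_pos (conjExp_pos hp) (betaArg_pos hd hp hη hην)) (by linarith)

lemma constC_eq (hp : 2 < p) (hη : 0 ≤ η) (hην : η < ν) :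
    constC d d p ν η = gammaT d p ν η ^ (-(gammaT d p ν η * (p⁻¹).toReal)) *
      ((1 - gammaT d p ν η) / d) ^ (-((1 - gammaT d p ν η) / 2)) *
      betaFactor d p ν η ^ (gammaT d p ν η * thetaP p) := by
  rw [constC, qT_mul_gammaT hp hη hην, abs_of_pos (sub_pos.2 hην), betaFactor, betaArg]
  congr 2
  rw [qT_eq, one_div_one_div]

lemma constC_pos (hd : 0 < d) (hp : 2 < p) (hη : 0 ≤ η) (hην : η < ν) :
    0 < constC d d p ν η := by
  have := betaFactor_pos hd hp hη hην
  have := gammaT_pos (d := d) hp hη hην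
  have : 0 < 1 - gammaT d p ν η := by linarith [gammaT_lt_one hd hp hη hην]
  have : (0 : ℝ) < d := by exact_mod_cast hd
  rw [constC_eq hp hη hην]
  positivity

lemma constBeta_pos (hd : 0 < d) (hp : 2 < p) (hη : 0 ≤ η) (hην : η < ν) (hδ : 0 < δ)
    (hI : 0 < constI p ν η ψ) : 0 < constBeta p ν η δ ψ := by
  have := constC_pos hd hp hη hην
  have : 0 < 1 - gammaT d p ν η := by linarith [gammaT_lt_one hd hp hη hην]
  have : (0 : ℝ) < d := by exact_mod_cast hd
  unfold constBeta
  positivity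

lemma constK_pos (hd : 0 < d) (hp : 2 < p) (hη : 0 ≤ η) (hην : η < ν)
    (hI : 0 < constI p ν η ψ) : 0 < constK p ν η ψ := by
  have := constC_pos hd hp hη hην
  unfold constK
  positivity

/-- The integral of `(|ψ|² - β ∑ |ξ_j|^{2ν})₊^r`, `r = conjExp p`. -/
noncomputable def truncIntegral (p : ℝ≥0∞) (ν η β : ℝ) (ψ : E d → ℂ) : ℝ :=
  gammaT d p ν η * (constI p ν η ψ * betaFactor d p ν η) * β ^ (-betaArg d p ν η)

lemma truncIntegral_pos (hd : 0 < d) (hp : 2 < p) (hη : 0 ≤ η) (hην : η < ν) {β : ℝ} (hβ : 0 < β)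
    (hI : 0 < constI p ν η ψ) : 0 < truncIntegral p ν η β ψ := by
  have := betaFactor_pos hd hp hη hην
  have := gammaT_pos (d := d) hp hη hην
  unfold truncIntegral
  positivity

/-- The right side is (2π)^{-d} times the minimal value of the Hölder bound; since 1/q̃ = γθ, the
definitions of K and β differ only by the factor d/(1-γ) and the square. -/
lemma constBeta_mul_eq_sq (hd : 0 < d) (hp : 2 < p) (hη : 0 ≤ η) (hην : η < ν) (hδ : 0 < δ)
    (hI : 0 < constI p ν η ψ) :
    d * constBeta p ν η δ ψ / (1 - gammaT d p ν η) =
      (constK p ν η ψ * δ ^ gammaT d p ν η) ^ 2 := by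
  have hC := constC_pos hd hp hη hην
  have hγ : 0 < 1 - gammaT d p ν η := by linarith [gammaT_lt_one hd hp hη hην]
  have hd' : (0 : ℝ) < d := by exact_mod_cast hd
  have e1 : (δ * constI p ν η ψ ^ (1 / 2 - (p⁻¹).toReal)) ^ (2 * gammaT d p ν η) =
      (δ ^ gammaT d p ν η) ^ 2 * (constI p ν η ψ ^ (1 / qT d p ν η)) ^ 2 := by
    rw [Real.mul_rpow hδ.le (by positivity), ← Real.rpow_mul hI.le, ← Real.rpow_mul_natCast hδ.le,
      ← Real.rpow_mul_natCast hI.le, qT]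
    congr 2
    · push_cast; ring
    · push_cast; rw [one_div_one_div]; ring
  have e2 : ((2 * Real.pi) ^ (d * gammaT d p ν η / 2)) ^ 2 =
      (2 * Real.pi) ^ (d * gammaT d p ν η) := by
    rw [← Real.rpow_mul_natCast (by positivity)]
    congr 1
    push_cast; ring
  rw [constBeta, e1, constK, ← e2]
  field_simp

/-- This is the stationarity condition in β of dβ + T(β), where T(β) = (2π)^{-d}δ²J(β)^{2θ} is
proportional to β^{1 - 1/γ}. At this β the sum equals dβ/(1-γ). -/
lemma truncIntegral_constBeta (hd : 0 < d) (hp : 2 < p) (hη : 0 ≤ η) (hην : η < ν) (hδ : 0 < δ)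
    (hI : 0 < constI p ν η ψ) :
    (2 * Real.pi) ^ (-(d : ℝ)) * δ ^ 2 *
        truncIntegral p ν η (constBeta p ν η δ ψ) ψ ^ (2 * thetaP p) =
      d * constBeta p ν η δ ψ * gammaT d p ν η / (1 - gammaT d p ν η) := by
  have hC := constC_pos hd hp hη hην
  have hB := betaFactor_pos hd hp hη hην
  have hγ0 := gammaT_pos (d := d) hp hη hην
  have hγ : 0 < 1 - gammaT d p ν η := by linarith [gammaT_lt_one hd hp hη hην]
  have hd' : (0 : ℝ) < d := by exact_mod_cast hd
  have hβ := constBeta_pos hd hp hη hην hδ hI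
  have hJ := truncIntegral_pos hd hp hη hην hβ hI
  have h2 : (p⁻¹).toReal = 1 / 2 - thetaP p := by unfold thetaP; ring
  have hbg := two_thetaP_mul_betaArg (d := d) hp hη hην
  have hπ : (0 : ℝ) < 2 * Real.pi := by positivity
  have lC : Real.log (constC d d p ν η) =
      -(gammaT d p ν η * (p⁻¹).toReal) * Real.log (gammaT d p ν η) +
      -((1 - gammaT d p ν η) / 2) * (Real.log (1 - gammaT d p ν η) - Real.log d) +
      gammaT d p ν η * thetaP p * Real.log (betaFactor d p ν η) := by
    rw [constC_eq hp hη hην, Real.log_mul (by positivity) (by positivity),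
      Real.log_mul (by positivity) (by positivity), Real.log_rpow (by positivity),
      Real.log_rpow (by positivity), Real.log_rpow (by positivity),
      Real.log_div (by positivity) (by positivity)]
  have lβ : Real.log (constBeta p ν η δ ψ) =
      Real.log (1 - gammaT d p ν η) - (Real.log d + d * gammaT d p ν η * Real.log (2 * Real.pi)) +
      2 * Real.log (constC d d p ν η) + 2 * gammaT d p ν η *
        (Real.log δ + thetaP p * Real.log (constI p ν η ψ)) := by
    rw [constBeta]
    generalize 2 * Real.pi = τ at hπ ⊢
    rw [Real.log_mul (by positivity) (by positivity),
      Real.log_mul (by positivity) (by positivity), Real.log_div (by positivity) (by positivity),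
      Real.log_mul (by positivity) (by positivity), Real.log_rpow (by positivity), Real.log_pow,
      Real.log_rpow (by positivity), Real.log_mul (by positivity) (by positivity),
      Real.log_rpow (by positivity)]
    push_cast
    rfl
  have lJ : Real.log (truncIntegral p ν η (constBeta p ν η δ ψ) ψ) =
      Real.log (gammaT d p ν η) + (Real.log (constI p ν η ψ) + Real.log (betaFactor d p ν η)) +
        -betaArg d p ν η * Real.log (constBeta p ν η δ ψ) := by
    rw [truncIntegral, Real.log_mul (by positivity) (by positivity),
      Real.log_mul (by positivity) (by positivity), Real.log_mul (by positivity) (by positivity),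
      Real.log_rpow (by positivity)]
  generalize 2 * Real.pi = τ at hπ lβ ⊢
  -- Both sides are products of powers of positive numbers, so after taking logarithms the identity
  -- is linear in the logarithms.
  refine Real.log_injOn_pos (Set.mem_Ioi.2 (by positivity)) (Set.mem_Ioi.2 (by positivity)) ?_
  rw [Real.log_mul (by positivity) (by positivity), Real.log_mul (by positivity) (by positivity),
    Real.log_rpow (by positivity), Real.log_pow, Real.log_rpow (by positivity),
    Real.log_div (by positivity) (by positivity), Real.log_mul (by positivity) (by positivity),
    Real.log_mul (by positivity) (by positivity), lJ]
  generalize hL : Real.log (constBeta p ν η δ ψ) = L at *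
  have key : 1 / gammaT d p ν η * L = -d * Real.log τ + 2 * Real.log δ +
      2 * thetaP p * (Real.log (gammaT d p ν η) + (Real.log (constI p ν η ψ) +
        Real.log (betaFactor d p ν η))) + Real.log (1 - gammaT d p ν η) - Real.log d -
        Real.log (gammaT d p ν η) := by
    rw [lβ, lC, h2]
    field_simp
    ring
  push_cast
  linear_combination -key - L * hbg

end Parameters

/-! ### Hölder's inequality for the truncated term -/

lemma eLpNorm_two_sq {α : Type*} [MeasurableSpace α] {μ : Measure α} (f : α → ℂ) :
    eLpNorm f 2 μ ^ 2 = ∫⁻ x, ‖f x‖ₑ ^ 2 ∂μ := by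
  have h := eLpNorm_nnreal_pow_eq_lintegral (f := f) (μ := μ) (p := 2) (by norm_num)
  simpa using h

/-- Hölder's inequality with the exponents `conjExp p` and `p / 2`. -/
lemma lintegral_mul_enorm_sq_le {α : Type*} [MeasurableSpace α] {μ : Measure α} {p : ℝ≥0∞}
    (hp : 2 < p) {g : α → ℝ≥0∞} (hg : AEMeasurable g μ) {z : α → ℂ}
    (hz : AEStronglyMeasurable z μ) :
    ∫⁻ x, g x * ‖z x‖ₑ ^ 2 ∂μ ≤
      (∫⁻ x, g x ^ conjExp p ∂μ) ^ (2 * thetaP p) * eLpNorm z p μ ^ 2 := by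
  -- For p = ∞ both r and 2θ equal 1, and the estimate is the L₁–L_∞ bound.
  rcases eq_or_ne p ∞ with rfl | hp'
  · have h1 : thetaP ∞ = 1 / 2 := by simp [thetaP]
    have h2 : conjExp ∞ = 1 := by rw [conjExp, h1]; norm_num
    rw [h1, h2]
    simp only [ENNReal.rpow_one, mul_one_div_cancel (two_ne_zero' ℝ), eLpNorm_exponent_top]
    rw [← lintegral_mul_const'' _ hg]
    refine lintegral_mono_ae ?_
    filter_upwards [ae_le_eLpNormEssSup (f := z) (μ := μ)] with x hx
    gcongr
  · have hθ := thetaP_pos hp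
    have hp2 : 2 < p.toReal := by
      have := (ENNReal.toReal_lt_toReal (by simp) hp').2 hp
      simpa using this
    have hθ2 : thetaP p = 1 / 2 - p.toReal⁻¹ := by rw [thetaP, ENNReal.toReal_inv]
    have hconj : (conjExp p).HolderConjugate (p.toReal / 2) := by
      rw [Real.holderConjugate_iff, conjExp, hθ2, inv_inv]
      constructor
      · rw [one_lt_inv₀ (by linarith)]
        have : 0 < p.toReal⁻¹ := by positivity
        linarith
      · field_simp
        ring
    have h := ENNReal.lintegral_mul_le_Lp_mul_Lq μ hconj hg (hz.enorm.pow_const 2)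
    refine h.trans (le_of_eq ?_)
    congr 1
    · rw [conjExp, one_div, inv_inv]
    · rw [eLpNorm_eq_lintegral_rpow_enorm_toReal (by positivity) hp', ← ENNReal.rpow_natCast,
        ← ENNReal.rpow_mul]
      congr 1
      · refine lintegral_congr fun x => ?_
        rw [← ENNReal.rpow_natCast, ← ENNReal.rpow_mul]
        congr 1
        push_cast
        ring
      · push_cast
        field_simp

/-! ### The integrals I and J, and the basic estimate -/

section Integrals

variable {d : ℕ} {p : ℝ≥0∞} {ν η δ : ℝ} {ψ : E d → ℂ}

lemma norm_derivSymbol (hν : 0 < ν) (j : Fin d) (ξ : E d) :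
    ‖derivSymbol d ν j ξ‖ = |ξ j| ^ ν := by
  rw [derivSymbol, iPow, norm_prod, Finset.prod_eq_single j]
  · rw [Pi.single_eq_same]
    rcases eq_or_ne (ξ j) 0 with h | h
    · rw [h]
      have : (ν : ℂ) ≠ 0 := by exact_mod_cast hν.ne'
      simp [this, hν.ne']
    -- The exponent is real, so the argument of iξ_j does not affect the modulus.
    · rw [Complex.norm_cpow_of_ne_zero (by simp [h])]
      simp
  · intro k _ hk
    simp [Pi.single_eq_of_ne hk]
  · simp

lemma measurable_derivSymbol (j : Fin d) : Measurable (derivSymbol d ν j) := by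
  unfold derivSymbol iPow
  fun_prop

lemma enorm_derivSymbol_mul_sq (hν : 0 < ν) (j : Fin d) (ξ : E d) (z : ℂ) :
    ‖derivSymbol d ν j ξ * z‖ₑ ^ 2 = ENNReal.ofReal (|ξ j| ^ (2 * ν) * ‖z‖ ^ 2) := by
  rw [← ofReal_norm, norm_mul, norm_derivSymbol hν, ← ENNReal.ofReal_pow (by positivity), mul_pow,
    ← Real.rpow_mul_natCast (abs_nonneg _)]
  congr 3
  push_cast; ring

lemma sum_lintegral_derivSymbol (hν : 0 < ν) {f : E d → ℂ} (hf : AEStronglyMeasurable f volume) :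
    ∑ j, ∫⁻ ξ, ‖derivSymbol d ν j ξ * f ξ‖ₑ ^ 2 =
      ∫⁻ ξ, ENNReal.ofReal (powSum ν ξ * ‖f ξ‖ ^ 2) := by
  have hm : ∀ j ∈ Finset.univ,
      AEMeasurable (fun ξ => ‖derivSymbol d ν j ξ * f ξ‖ₑ ^ 2) volume := fun j _ =>
    ((measurable_derivSymbol j).aestronglyMeasurable.mul hf).enorm.pow_const 2
  rw [← lintegral_finsetSum' _ hm]
  refine lintegral_congr fun ξ => ?_
  simp only [enorm_derivSymbol_mul_sq hν]
  rw [← ENNReal.ofReal_sum_of_nonneg fun _ _ => by positivity, powSum, Finset.sum_mul]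

lemma integrandI_eq : integrandI p ν η ψ = fun ω : Metric.sphere (0 : E d) 1 =>
    ‖ψ ω‖ ^ qT d p ν η / powSum ν (ω : E d) ^ betaArg d p ν η := rfl

lemma continuous_integrandI (hp : 2 < p) (hη : 0 ≤ η) (hην : η < ν)
    (hcont : Continuous fun ω : Metric.sphere (0 : E d) 1 => ‖ψ ω‖) :
    Continuous (integrandI p ν η ψ) := by
  have hq := qT_pos (d := d) hp hη hην
  rw [integrandI_eq]
  have hS : ∀ ω : Metric.sphere (0 : E d) 1, 0 < powSum ν (ω : E d) := fun ω =>
    powSum_pos (ne_zero_of_mem_unit_sphere ω)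
  refine (hcont.rpow_const fun _ => Or.inr hq.le).div
    (((continuous_powSum (by linarith)).comp continuous_subtype_val).rpow_const
      fun ω => Or.inl (hS ω).ne') fun ω => (Real.rpow_pos_of_pos (hS ω) _).ne'

lemma integrandI_nonneg (ω : Metric.sphere (0 : E d) 1) : 0 ≤ integrandI p ν η ψ ω := by
  have : 0 ≤ powSum ν (ω : E d) := powSum_nonneg _
  rw [integrandI_eq]
  positivity

lemma integrable_integrandI (hp : 2 < p) (hη : 0 ≤ η) (hην : η < ν)
    (hcont : Continuous fun ω : Metric.sphere (0 : E d) 1 => ‖ψ ω‖) :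
    Integrable (integrandI p ν η ψ) (volume : Measure (E d)).toSphere :=
  (continuous_integrandI hp hη hην hcont).integrable_of_hasCompactSupport
    (HasCompactSupport.of_compactSpace _)

/-- Some nonzero ξ has ψ(ξ) ≠ 0, and homogeneity carries this to ξ/‖ξ‖. A continuous nonnegative
integrand that is positive at one point has positive integral. -/
lemma constI_pos (hd : 0 < d) (hp : 2 < p) (hη : 0 ≤ η) (hην : η < ν)
    (hhom : ∀ t : ℝ, 0 < t → ∀ ξ : E d, ‖ψ (t • ξ)‖ = t ^ η * ‖ψ ξ‖)
    (hne : ∀ᵐ ξ : E d, ψ ξ ≠ 0)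
    (hcont : Continuous fun ω : Metric.sphere (0 : E d) 1 => ‖ψ ω‖) : 0 < constI p ν η ψ := by
  have : Nonempty (Fin d) := ⟨⟨0, hd⟩⟩
  obtain ⟨ξ, hξ, hξ0⟩ := (hne.and (Measure.ae_ne volume (0 : E d))).exists
  have hn : 0 < ‖ξ‖ := norm_pos_iff.2 hξ0
  let ω : Metric.sphere (0 : E d) 1 := ⟨‖ξ‖⁻¹ • ξ, by simp [norm_smul, hn.ne']⟩
  have hω : ‖ψ ω‖ ≠ 0 := by
    have h := hhom _ hn (‖ξ‖⁻¹ • ξ)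
    rw [smul_inv_smul₀ hn.ne'] at h
    intro h0
    rw [show ‖ψ (‖ξ‖⁻¹ • ξ)‖ = 0 from h0, mul_zero, norm_eq_zero] at h
    exact hξ h
  refine Continuous.integral_pos_of_hasCompactSupport_nonneg_nonzero (x := ω)
    (continuous_integrandI hp hη hην hcont) (HasCompactSupport.of_compactSpace _)
    integrandI_nonneg ?_
  have : 0 < powSum ν (ω : E d) := powSum_pos (ne_zero_of_mem_unit_sphere ω)
  have : 0 < ‖ψ ω‖ := (norm_nonneg _).lt_of_ne' hω
  rw [integrandI_eq]
  positivity

lemma lintegral_integrandI (hp : 2 < p) (hη : 0 ≤ η) (hην : η < ν)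
    (hcont : Continuous fun ω : Metric.sphere (0 : E d) 1 => ‖ψ ω‖) :
    ∫⁻ ω, ENNReal.ofReal (integrandI p ν η ψ ω) ∂(volume : Measure (E d)).toSphere =
      ENNReal.ofReal (constI p ν η ψ) :=
  (ofReal_integral_eq_lintegral_ofReal (integrable_integrandI hp hη hην hcont)
    (Filter.Eventually.of_forall integrandI_nonneg)).symm

/-- The ray formula with e = 0, m = r + 1, a = b gives exactly the integrand of I, and B(b, r+1) = γ
B(r, b). -/
lemma lintegral_truncPow_conjExp (hd : 0 < d) (hp : 2 < p) (hη : 0 ≤ η) (hην : η < ν)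
    (hhom : ∀ t : ℝ, 0 < t → ∀ ξ : E d, ‖ψ (t • ξ)‖ = t ^ η * ‖ψ ξ‖)
    (hcont : Continuous fun ω : Metric.sphere (0 : E d) 1 => ‖ψ ω‖) {β : ℝ} (hβ : 0 < β) :
    ∫⁻ ξ : E d, ENNReal.ofReal (truncPow (conjExp p) (‖ψ ξ‖ ^ 2 - β * powSum ν ξ)) =
      ENNReal.ofReal (truncIntegral p ν η β ψ) := by
  have : Nonempty (Fin d) := ⟨⟨0, hd⟩⟩
  have hr := conjExp_pos hp
  have hb := betaArg_pos hd hp hη hην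
  have h := lintegral_powSum_mul_truncPow (e := 0) (m := conjExp p + 1) (a := betaArg d p ν η)
    hd (by linarith) hhom hcont hβ (by positivity) hb hην (by simp; positivity)
    (by rw [betaArg_mul hp hη hην]; ring)
  simp only [Real.rpow_zero, one_mul, add_sub_cancel_right, betaArg_add_conjExp hp hη hην,
    zero_sub] at h
  have h2 := lintegral_integrandI (p := p) hp hη hην hcont
  simp only [integrandI_eq, div_eq_mul_inv] at h2
  simp only [Real.rpow_neg (powSum_nonneg _)] at h
  rw [h, h2, ← ENNReal.ofReal_mul]
  · congr 1
    rw [truncIntegral, betaFactor, beta_add_one_right hr hb]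
    have : conjExp p / (betaArg d p ν η + conjExp p) = gammaT d p ν η := by
      rw [div_eq_iff (by positivity)]
      exact conjExp_eq_gammaT_mul hp hη hην
    rw [this]
    ring
  · have := ProbabilityTheory.beta_pos hb (β := conjExp p + 1) (by positivity)
    have : 0 < ν - η := by linarith
    positivity

/-- The value is -J'(β)/r. It comes from the ray formula with e = 1, m = r, a = b + 1, where B(b+1,
r) = (1-γ) B(r, b). -/
lemma lintegral_powSum_mul_truncPow_conjExp (hd : 0 < d) (hp : 2 < p) (hη : 0 ≤ η) (hην : η < ν)
    (hhom : ∀ t : ℝ, 0 < t → ∀ ξ : E d, ‖ψ (t • ξ)‖ = t ^ η * ‖ψ ξ‖)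
    (hcont : Continuous fun ω : Metric.sphere (0 : E d) 1 => ‖ψ ω‖) {β : ℝ} (hβ : 0 < β) :
    ∫⁻ ξ : E d, ENNReal.ofReal (powSum ν ξ *
        truncPow (conjExp p - 1) (‖ψ ξ‖ ^ 2 - β * powSum ν ξ)) =
      ENNReal.ofReal (truncIntegral p ν η β ψ * (1 - gammaT d p ν η) / (gammaT d p ν η * β)) := by
  have : Nonempty (Fin d) := ⟨⟨0, hd⟩⟩
  have hr := conjExp_pos hp
  have hb := betaArg_pos hd hp hη hην
  have hγ := gammaT_pos (d := d) hp hη hην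
  have h := lintegral_powSum_mul_truncPow (e := 1) (m := conjExp p) (a := betaArg d p ν η + 1)
    hd (by linarith) hhom hcont hβ hr (by positivity) hην (by linarith)
    (by rw [mul_add, betaArg_mul hp hη hην]; ring)
  have e1 : 2 * (betaArg d p ν η + 1 + (conjExp p - 1)) = qT d p ν η := by
    rw [← betaArg_add_conjExp hp hη hην]; ring
  have e2 : 1 - (betaArg d p ν η + 1) = -betaArg d p ν η := by ring
  simp only [Real.rpow_one, e1, e2] at h
  have h2 := lintegral_integrandI (p := p) hp hη hην hcont
  simp only [integrandI_eq, div_eq_mul_inv] at h2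
  simp only [Real.rpow_neg (powSum_nonneg _)] at h
  rw [h, h2, ← ENNReal.ofReal_mul]
  · congr 1
    rw [truncIntegral, betaFactor, beta_add_one_left hr hb]
    have : betaArg d p ν η / (betaArg d p ν η + conjExp p) = 1 - gammaT d p ν η := by
      rw [div_eq_iff (by positivity)]
      linarith [conjExp_eq_gammaT_mul (d := d) hp hη hην]
    rw [this, neg_add, Real.rpow_add hβ, Real.rpow_neg_one]
    field_simp
  · have := ProbabilityTheory.beta_pos (α := betaArg d p ν η + 1) (β := conjExp p)
      (by positivity) hr
    have : 0 < ν - η := by linarith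
    positivity

/-- The pointwise bound is integrated; Hölder treats the term with z. Keeping f, z and w separate
lets one estimate serve the inequality, the filter error and the membership in L₂. -/
lemma eLpNorm_sq_le (hd : 0 < d) (hp : 2 < p) (hη : 0 ≤ η) (hην : η < ν)
    (hhom : ∀ t : ℝ, 0 < t → ∀ ξ : E d, ‖ψ (t • ξ)‖ = t ^ η * ‖ψ ξ‖)
    (hcont : Continuous fun ω : Metric.sphere (0 : E d) 1 => ‖ψ ω‖)
    (hI : 0 < constI p ν η ψ) {β : ℝ} (hβ : 0 < β)
    {f z w : E d → ℂ} (hf : AEStronglyMeasurable f volume) (hz : AEStronglyMeasurable z volume)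
    (hw : ∀ ξ, ‖w ξ‖ ^ 2 ≤ β * (powSum ν ξ * ‖f ξ‖ ^ 2) +
      truncPow 1 (‖ψ ξ‖ ^ 2 - β * powSum ν ξ) * ‖z ξ‖ ^ 2) :
    eLpNorm w 2 volume ^ 2 ≤
      ENNReal.ofReal β * ∑ j, eLpNorm (fun ξ => derivSymbol d ν j ξ * f ξ) 2 volume ^ 2 +
      ENNReal.ofReal (truncIntegral p ν η β ψ ^ (2 * thetaP p)) * eLpNorm z p volume ^ 2 := by
  have hψm := measurable_norm_of_homogeneous hhom hcont
  have hSm : Measurable (powSum ν : E d → ℝ) := (continuous_powSum (by linarith)).measurable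
  have hJ := truncIntegral_pos hd hp hη hην hβ hI
  simp only [eLpNorm_two_sq]
  rw [sum_lintegral_derivSymbol (by linarith) hf]
  have hgm : Measurable fun ξ : E d =>
      ENNReal.ofReal (truncPow 1 (‖ψ ξ‖ ^ 2 - β * powSum ν ξ)) := by
    fun_prop (disch := assumption)
  have hH := lintegral_mul_enorm_sq_le hp hgm.aemeasurable hz
  have e1 : ∀ ξ : E d, ENNReal.ofReal (truncPow 1 (‖ψ ξ‖ ^ 2 - β * powSum ν ξ)) ^ conjExp p =
      ENNReal.ofReal (truncPow (conjExp p) (‖ψ ξ‖ ^ 2 - β * powSum ν ξ)) := by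
    intro ξ
    rw [ENNReal.ofReal_rpow_of_nonneg (truncPow_nonneg _ _) (conjExp_pos hp).le,
      truncPow_rpow (conjExp_pos hp).ne', one_mul]
  simp only [e1] at hH
  rw [lintegral_truncPow_conjExp hd hp hη hην hhom hcont hβ, ENNReal.ofReal_rpow_of_pos hJ] at hH
  refine le_trans ?_ (add_le_add_right hH _)
  have hm : AEMeasurable (fun ξ => ENNReal.ofReal (truncPow 1 (‖ψ ξ‖ ^ 2 - β * powSum ν ξ)) *
      ‖z ξ‖ₑ ^ 2) volume := hgm.aemeasurable.mul (hz.enorm.pow_const 2)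
  rw [← lintegral_const_mul' _ _ ENNReal.ofReal_ne_top, ← lintegral_add_right' _ hm]
  refine lintegral_mono fun ξ => ?_
  have hS := powSum_nonneg (ν := ν) ξ
  have ht := truncPow_nonneg 1 (‖ψ ξ‖ ^ 2 - β * powSum ν ξ)
  simp only [← ofReal_norm, ← ENNReal.ofReal_pow (norm_nonneg _), ← ENNReal.ofReal_mul hβ.le,
    ← ENNReal.ofReal_mul ht]
  rw [← ENNReal.ofReal_add (by positivity) (by positivity)]
  exact ENNReal.ofReal_le_ofReal (hw ξ)

end Integrals

/-! ### Upper bounds: the inequality and the filter -/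

section Bounds

variable {d : ℕ} {p : ℝ≥0∞} {ν η δ : ℝ} {ψ : E d → ℂ}

/-- The constant in Plancherel's theorem for `F⁻¹`. -/
noncomputable def plancherelConst (d : ℕ) : ℝ≥0∞ := ENNReal.ofReal ((2 * Real.pi) ^ (-(d / 2 : ℝ)))

lemma plancherelConst_sq : plancherelConst d ^ 2 = ENNReal.ofReal ((2 * Real.pi) ^ (-(d : ℝ))) := by
  rw [plancherelConst, ← ENNReal.ofReal_pow (by positivity), ← Real.rpow_mul_natCast (by positivity)]
  congr 2
  push_cast; ring

lemma multOp_eq {q : ℝ≥0∞} [Fact (1 ≤ q)] {x : 𝓢'(E d, ℂ)} {f : Lp ℂ q (volume : Measure (E d))}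
    (hx : F x = (f : 𝓢'(E d, ℂ))) {φ : E d → ℂ} {h : Lp ℂ 2 (volume : Measure (E d))}
    (hh : h =ᵐ[volume] fun ξ => φ ξ * f ξ) : multOp φ x = Finv (h : 𝓢'(E d, ℂ)) := by
  rw [multOp]
  congr 1
  refine funcDist_eq ((isDensity_toTemperedDistribution h).congr_ae (hh.trans ?_))
  rw [hx]
  filter_upwards [density_ae_eq (isDensity_toTemperedDistribution f)] with ξ hξ
  rw [hξ]

lemma lqNorm_multOp {q : ℝ≥0∞} [Fact (1 ≤ q)] {x : 𝓢'(E d, ℂ)}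
    {f : Lp ℂ q (volume : Measure (E d))}
    (hx : F x = (f : 𝓢'(E d, ℂ))) {φ : E d → ℂ} (hφ : MemLp (fun ξ => φ ξ * f ξ) 2 volume) :
    lqNorm 2 (multOp φ x) =
      plancherelConst d * eLpNorm (fun ξ => φ ξ * f ξ) 2 volume := by
  rw [multOp_eq hx hφ.coeFn_toLp, lqNorm_Finv_toTemperedDistribution, Lp.enorm_toLp,
    plancherelConst]

/-- Both a Carlson-type inequality (`w = ψ f`, `z = f`) and the error bound for the filter method
(`w = ψ f - filter · y`, `z = f - y`). -/
lemma plancherelConst_mul_eLpNorm_le (hd : 0 < d) (hp : 2 < p) (hη : 0 ≤ η) (hην : η < ν)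
    (hhom : ∀ t : ℝ, 0 < t → ∀ ξ : E d, ‖ψ (t • ξ)‖ = t ^ η * ‖ψ ξ‖)
    (hcont : Continuous fun ω : Metric.sphere (0 : E d) 1 => ‖ψ ω‖)
    (hI : 0 < constI p ν η ψ) {A D : ℝ} (hA : 0 < A) (hD : 0 < D)
    {f z w : E d → ℂ} (hf : AEStronglyMeasurable f volume) (hz : AEStronglyMeasurable z volume)
    (hfD : ∀ j, plancherelConst d * eLpNorm (fun ξ => derivSymbol d ν j ξ * f ξ) 2 volume ≤
      ENNReal.ofReal D)
    (hzA : eLpNorm z p volume ≤ ENNReal.ofReal A)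
    (hw : ∀ ξ, ‖w ξ‖ ^ 2 ≤ constBeta p ν η (A / D) ψ * (powSum ν ξ * ‖f ξ‖ ^ 2) +
      truncPow 1 (‖ψ ξ‖ ^ 2 - constBeta p ν η (A / D) ψ * powSum ν ξ) * ‖z ξ‖ ^ 2) :
    plancherelConst d * eLpNorm w 2 volume ≤
      ENNReal.ofReal (constK p ν η ψ * A ^ gammaT d p ν η * D ^ (1 - gammaT d p ν η)) := by
  have hδ : 0 < A / D := by positivity
  have hβ := constBeta_pos hd hp hη hην hδ hI
  have hγ0 := gammaT_pos (d := d) hp hη hην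
  have hγ1 : 0 < 1 - gammaT d p ν η := by linarith [gammaT_lt_one hd hp hη hην]
  have hK := constK_pos hd hp hη hην hI
  have hJ := truncIntegral_pos hd hp hη hην hβ hI
  have h1 := eLpNorm_sq_le hd hp hη hην hhom hcont hI hβ hf hz hw
  have e1 := constBeta_mul_eq_sq hd hp hη hην hδ hI
  have e2 := truncIntegral_constBeta hd hp hη hην hδ hI
  set β := constBeta p ν η (A / D) ψ
  set J := truncIntegral p ν η β ψ
  refine (ENNReal.pow_le_pow_left_iff two_ne_zero).1 ?_
  calc (plancherelConst d * eLpNorm w 2 volume) ^ 2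
      = plancherelConst d ^ 2 * eLpNorm w 2 volume ^ 2 := mul_pow _ _ _
    _ ≤ plancherelConst d ^ 2 * (ENNReal.ofReal β *
          ∑ j, eLpNorm (fun ξ => derivSymbol d ν j ξ * f ξ) 2 volume ^ 2 +
          ENNReal.ofReal (J ^ (2 * thetaP p)) * eLpNorm z p volume ^ 2) := by gcongr
    _ = ENNReal.ofReal β * ∑ j, (plancherelConst d *
          eLpNorm (fun ξ => derivSymbol d ν j ξ * f ξ) 2 volume) ^ 2 +
          plancherelConst d ^ 2 * ENNReal.ofReal (J ^ (2 * thetaP p)) * eLpNorm z p volume ^ 2 := by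
        simp only [mul_pow, ← Finset.mul_sum]
        ring
    _ ≤ ENNReal.ofReal β * ∑ j : Fin d, ENNReal.ofReal D ^ 2 +
          plancherelConst d ^ 2 * ENNReal.ofReal (J ^ (2 * thetaP p)) * ENNReal.ofReal A ^ 2 := by
        gcongr with j
        exact hfD j
    _ = ENNReal.ofReal (β * (d * D ^ 2) +
          (2 * Real.pi) ^ (-(d : ℝ)) * J ^ (2 * thetaP p) * A ^ 2) := by
        rw [plancherelConst_sq, Finset.sum_const, Finset.card_univ, Fintype.card_fin, nsmul_eq_mul,
          ENNReal.ofReal_add (by positivity) (by positivity), ENNReal.ofReal_mul hβ.le,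
          ENNReal.ofReal_mul (by positivity), ENNReal.ofReal_mul (by positivity),
          ENNReal.ofReal_mul (by positivity), ENNReal.ofReal_pow hD.le, ENNReal.ofReal_pow hA.le,
          ENNReal.ofReal_natCast]
    _ = ENNReal.ofReal
          (constK p ν η ψ * A ^ gammaT d p ν η * D ^ (1 - gammaT d p ν η)) ^ 2 := by
        rw [← ENNReal.ofReal_pow (by positivity)]
        congr 1
        -- Homogeneity reduces the claim to D = 1 with A/D in the role of δ; there the two terms add
        -- up to dβ + dβγ/(1-γ) = dβ/(1-γ).
        have e3 : constK p ν η ψ * A ^ gammaT d p ν η * D ^ (1 - gammaT d p ν η) =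
            D * (constK p ν η ψ * (A / D) ^ gammaT d p ν η) := by
          rw [Real.div_rpow hA.le hD.le, Real.rpow_sub hD, Real.rpow_one]
          field_simp
        rw [e3, mul_pow, ← e1]
        have e4 : (2 * Real.pi) ^ (-(d : ℝ)) * J ^ (2 * thetaP p) * A ^ 2 =
            D ^ 2 * ((2 * Real.pi) ^ (-(d : ℝ)) * (A / D) ^ 2 * J ^ (2 * thetaP p)) := by
          field_simp
        rw [e4, e2]
        field_simp
        ring

lemma norm_mul_sq_le (β : ℝ) (z : E d → ℂ) (ξ : E d) :
    ‖ψ ξ * z ξ‖ ^ 2 ≤ β * (powSum ν ξ * ‖z ξ‖ ^ 2) +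
      truncPow 1 (‖ψ ξ‖ ^ 2 - β * powSum ν ξ) * ‖z ξ‖ ^ 2 := by
  have h : ∀ x : ℝ, x ≤ truncPow 1 x := by
    intro x
    rcases lt_or_ge 0 x with hx | hx
    · rw [truncPow_of_pos hx, Real.rpow_one]
    · rw [truncPow_of_nonpos hx]; exact hx
  have h1 := mul_le_mul_of_nonneg_right (h (‖ψ ξ‖ ^ 2 - β * powSum ν ξ)) (sq_nonneg ‖z ξ‖)
  rw [norm_mul, mul_pow]
  linarith

/-- The factor `(1 - β ∑ |ξ_j|^{2ν} / |ψ(ξ)|²)₊`. -/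
noncomputable def cutoff (p : ℝ≥0∞) (ν η δ : ℝ) (ψ : E d → ℂ) (ξ : E d) : ℝ :=
  max (1 - constBeta p ν η δ ψ * powSum ν ξ / ‖ψ ξ‖ ^ 2) 0

lemma filter_eq (ξ : E d) : filter p ν η δ ψ ξ = (cutoff p ν η δ ψ ξ : ℂ) * ψ ξ := rfl

lemma cutoff_nonneg (ξ : E d) : 0 ≤ cutoff p ν η δ ψ ξ := le_max_right _ _

lemma cutoff_le_one (hβ : 0 ≤ constBeta p ν η δ ψ) (ξ : E d) : cutoff p ν η δ ψ ξ ≤ 1 := by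
  have hS := powSum_nonneg (ν := ν) ξ
  refine max_le ?_ zero_le_one
  have : 0 ≤ constBeta p ν η δ ψ * powSum ν ξ / ‖ψ ξ‖ ^ 2 := by positivity
  linarith

/-- Where ψ(ξ) = 0, division by zero makes the cutoff 1, but the factor |ψ|² removes it. -/
lemma norm_sq_mul_cutoff (hβ : 0 ≤ constBeta p ν η δ ψ) (ξ : E d) :
    ‖ψ ξ‖ ^ 2 * cutoff p ν η δ ψ ξ =
      truncPow 1 (‖ψ ξ‖ ^ 2 - constBeta p ν η δ ψ * powSum ν ξ) := by
  have hS := mul_nonneg hβ (powSum_nonneg (ν := ν) ξ)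
  rcases (norm_nonneg (ψ ξ)).eq_or_lt with h0 | h0
  · rw [← h0, truncPow_of_nonpos (by linarith)]
    ring
  · have e : ‖ψ ξ‖ ^ 2 - constBeta p ν η δ ψ * powSum ν ξ =
        ‖ψ ξ‖ ^ 2 * (1 - constBeta p ν η δ ψ * powSum ν ξ / ‖ψ ξ‖ ^ 2) := by
      field_simp
    rw [e, truncPow_mul (by positivity), Real.rpow_one, cutoff]
    congr 1
    rcases lt_or_ge 0 (1 - constBeta p ν η δ ψ * powSum ν ξ / ‖ψ ξ‖ ^ 2) with hx | hx
    · rw [truncPow_of_pos hx, Real.rpow_one, max_eq_left hx.le]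
    · rw [truncPow_of_nonpos hx, max_eq_right hx]

/-- With a the cutoff, the left side is |ψ|² |(1-a)u + a(u-v)|². Convexity of the square separates u
from u - v, and |ψ|²(1-a) ≤ βS, |ψ|²a = (|ψ|² - βS)₊. -/
lemma norm_sub_filter_mul_sq_le (hβ : 0 ≤ constBeta p ν η δ ψ) (ξ : E d) (u v : ℂ) :
    ‖ψ ξ * u - filter p ν η δ ψ ξ * v‖ ^ 2 ≤ constBeta p ν η δ ψ * (powSum ν ξ * ‖u‖ ^ 2) +
      truncPow 1 (‖ψ ξ‖ ^ 2 - constBeta p ν η δ ψ * powSum ν ξ) * ‖u - v‖ ^ 2 := by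
  have h0 := cutoff_nonneg (p := p) (ν := ν) (η := η) (δ := δ) (ψ := ψ) ξ
  have h1 := cutoff_le_one hβ ξ
  have h2 := norm_sq_mul_cutoff hβ ξ
  have hS := mul_nonneg hβ (powSum_nonneg (ν := ν) ξ)
  set a := cutoff p ν η δ ψ ξ
  set S := constBeta p ν η δ ψ * powSum ν ξ with hSdef
  have h3 : ‖ψ ξ‖ ^ 2 * (1 - a) ≤ S := by
    have : ‖ψ ξ‖ ^ 2 - S ≤ truncPow 1 (‖ψ ξ‖ ^ 2 - S) := by
      rcases lt_or_ge 0 (‖ψ ξ‖ ^ 2 - S) with hx | hx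
      · rw [truncPow_of_pos hx, Real.rpow_one]
      · rw [truncPow_of_nonpos hx]; exact hx
    linarith
  have e1 : ψ ξ * u - filter p ν η δ ψ ξ * v =
      ψ ξ * (((1 - a : ℝ) : ℂ) * u + ((a : ℝ) : ℂ) * (u - v)) := by
    rw [filter_eq]
    push_cast
    ring
  have h4 : ‖((1 - a : ℝ) : ℂ) * u + ((a : ℝ) : ℂ) * (u - v)‖ ≤
      (1 - a) * ‖u‖ + a * ‖u - v‖ := by
    refine (norm_add_le _ _).trans (le_of_eq ?_)
    rw [norm_mul, norm_mul, Complex.norm_real, Complex.norm_real, Real.norm_of_nonneg h0,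
      Real.norm_of_nonneg (by linarith)]
  have h5 : ((1 - a) * ‖u‖ + a * ‖u - v‖) ^ 2 ≤ (1 - a) * ‖u‖ ^ 2 + a * ‖u - v‖ ^ 2 := by
    -- The difference of the two sides is a(1-a)(‖u‖ - ‖u-v‖)².
    nlinarith [mul_nonneg (mul_nonneg h0 (sub_nonneg.2 h1)) (sq_nonneg (‖u‖ - ‖u - v‖))]
  rw [e1, norm_mul, mul_pow, ← h2]
  calc ‖ψ ξ‖ ^ 2 * ‖((1 - a : ℝ) : ℂ) * u + ((a : ℝ) : ℂ) * (u - v)‖ ^ 2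
      ≤ ‖ψ ξ‖ ^ 2 * ((1 - a) * ‖u‖ ^ 2 + a * ‖u - v‖ ^ 2) := by
        gcongr
        exact (pow_le_pow_left₀ (norm_nonneg _) h4 2).trans h5
    _ = ‖ψ ξ‖ ^ 2 * (1 - a) * ‖u‖ ^ 2 + ‖ψ ξ‖ ^ 2 * a * ‖u - v‖ ^ 2 := by ring
    _ ≤ S * ‖u‖ ^ 2 + ‖ψ ξ‖ ^ 2 * a * ‖u - v‖ ^ 2 := by gcongr
    _ = _ := by rw [hSdef]; ring

lemma memLp_mul (hd : 0 < d) (hp : 2 < p) (hη : 0 ≤ η) (hην : η < ν)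
    (hhom : ∀ t : ℝ, 0 < t → ∀ ξ : E d, ‖ψ (t • ξ)‖ = t ^ η * ‖ψ ξ‖)
    (hcont : Continuous fun ω : Metric.sphere (0 : E d) 1 => ‖ψ ω‖)
    (hψ : AEStronglyMeasurable ψ volume) (hI : 0 < constI p ν η ψ) {f : E d → ℂ}
    (hf : MemLp f p volume)
    (hfj : ∀ j, MemLp (fun ξ => derivSymbol d ν j ξ * f ξ) 2 volume) :
    MemLp (fun ξ => ψ ξ * f ξ) 2 volume := by
  refine ⟨hψ.mul hf.1, ?_⟩
  -- Only finiteness is needed, so any β will do.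
  have h := eLpNorm_sq_le hd hp hη hην hhom hcont hI one_pos hf.1 hf.1 (norm_mul_sq_le (ψ := ψ) 1 f)
  refine (ENNReal.pow_lt_top_iff (n := 2)).1 (h.trans_lt ?_) |>.resolve_right two_ne_zero
  refine ENNReal.add_lt_top.2 ⟨ENNReal.mul_lt_top ENNReal.ofReal_lt_top ?_,
    ENNReal.mul_lt_top ENNReal.ofReal_lt_top (ENNReal.pow_lt_top hf.2)⟩
  exact ENNReal.sum_lt_top.2 fun j _ => ENNReal.pow_lt_top (hfj j).2

lemma memLp_filter_mul (hd : 0 < d) (hp : 2 < p) (hη : 0 ≤ η) (hην : η < ν)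
    (hhom : ∀ t : ℝ, 0 < t → ∀ ξ : E d, ‖ψ (t • ξ)‖ = t ^ η * ‖ψ ξ‖)
    (hcont : Continuous fun ω : Metric.sphere (0 : E d) 1 => ‖ψ ω‖)
    (hψ : AEStronglyMeasurable ψ volume) (hI : 0 < constI p ν η ψ) (hδ : 0 < δ) {y : E d → ℂ}
    (hy : MemLp y p volume) : MemLp (fun ξ => filter p ν η δ ψ ξ * y ξ) 2 volume := by
  have hβ := constBeta_pos hd hp hη hην hδ hI
  have hψm := measurable_norm_of_homogeneous hhom hcont
  have hSm : Measurable (powSum ν : E d → ℝ) := (continuous_powSum (by linarith)).measurable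
  have hm : Measurable (cutoff p ν η δ ψ) := by
    unfold cutoff
    fun_prop (disch := assumption)
  refine ⟨((Complex.measurable_ofReal.comp hm).aestronglyMeasurable.mul hψ).mul hy.1, ?_⟩
  -- The filter error bound with zero signal: only the L_p term remains.
  have h := eLpNorm_sq_le (f := 0) (w := fun ξ => filter p ν η δ ψ ξ * y ξ) hd hp hη hην hhom hcont
    hI hβ aestronglyMeasurable_zero hy.1 (fun ξ => by
      simpa using norm_sub_filter_mul_sq_le hβ.le ξ 0 (y ξ))
  refine (ENNReal.pow_lt_top_iff (n := 2)).1 (h.trans_lt ?_) |>.resolve_right two_ne_zero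
  simp only [Pi.zero_apply, mul_zero]
  simpa using ENNReal.mul_lt_top ENNReal.ofReal_lt_top (ENNReal.pow_lt_top hy.2)

end Bounds

/-! ### The extremal function -/

section Extremal

variable {d : ℕ} {p : ℝ≥0∞} {ν η δ : ℝ} {ψ : E d → ℂ}

/-- The interchange of two coordinates. -/
noncomputable def swapCoord (d : ℕ) (j m : Fin d) : E d ≃ₗᵢ[ℝ] E d :=
  LinearIsometryEquiv.piLpCongrLeft 2 ℝ ℝ (Equiv.swap j m)

lemma swapCoord_apply (j m : Fin d) (ξ : E d) :
    swapCoord d j m ξ = WithLp.toLp 2 fun k => ξ (Equiv.swap j m k) := by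
  ext k
  simp [swapCoord, LinearIsometryEquiv.piLpCongrLeft_apply, Equiv.piCongrLeft'_apply]

lemma powSum_swapCoord (j m : Fin d) (ξ : E d) :
    powSum ν (swapCoord d j m ξ) = powSum ν ξ := by
  rw [swapCoord_apply]
  exact Equiv.sum_comp (Equiv.swap j m) fun k => |ξ k| ^ (2 * ν)

/-- A coordinate interchange is an isometry, hence preserves the measure. -/
lemma lintegral_coord_eq {g : E d → ℝ} (hg : Measurable g)
    (hsymm : ∀ j m ξ, g (swapCoord d j m ξ) = g ξ) (j m : Fin d) :
    ∫⁻ ξ : E d, ENNReal.ofReal (|ξ j| ^ (2 * ν) * g ξ) =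
      ∫⁻ ξ : E d, ENNReal.ofReal (|ξ m| ^ (2 * ν) * g ξ) := by
  have hm : Measurable fun ξ : E d => ENNReal.ofReal (|ξ j| ^ (2 * ν) * g ξ) := by
    fun_prop (disch := assumption)
  rw [← (swapCoord d j m).measurePreserving.lintegral_comp hm]
  refine lintegral_congr fun ξ => ?_
  rw [hsymm, swapCoord_apply]
  simp

/-- The amplitude of the extremal function. -/
noncomputable def amplitude (p : ℝ≥0∞) (ν η δ : ℝ) (ψ : E d → ℂ) : ℝ :=
  δ * truncIntegral p ν η (constBeta p ν η δ ψ) ψ ^ (-(p⁻¹).toReal)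

/-- The Fourier transform of the extremal function. -/
noncomputable def extremal (p : ℝ≥0∞) (ν η δ : ℝ) (ψ : E d → ℂ) (ξ : E d) : ℝ :=
  amplitude p ν η δ ψ *
    truncPow (conjExp p * (p⁻¹).toReal) (‖ψ ξ‖ ^ 2 - constBeta p ν η δ ψ * powSum ν ξ)

lemma truncPow_sq (m x : ℝ) : truncPow m x ^ 2 = truncPow (2 * m) x := by
  rw [sq, truncPow_mul_truncPow, two_mul]

lemma extremal_sq (hp : 2 < p) (ξ : E d) : extremal p ν η δ ψ ξ ^ 2 =
    amplitude p ν η δ ψ ^ 2 *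
      truncPow (conjExp p - 1) (‖ψ ξ‖ ^ 2 - constBeta p ν η δ ψ * powSum ν ξ) := by
  rw [extremal, mul_pow, truncPow_sq, conjExp_sub_one hp]

variable (hd : 0 < d) (hp : 2 < p) (hη : 0 ≤ η) (hην : η < ν) (hδ : 0 < δ)
  (hhom : ∀ t : ℝ, 0 < t → ∀ ξ : E d, ‖ψ (t • ξ)‖ = t ^ η * ‖ψ ξ‖)
  (hcont : Continuous fun ω : Metric.sphere (0 : E d) 1 => ‖ψ ω‖)
  (hI : 0 < constI p ν η ψ)

include hd hp hη hην hδ hI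

/-- A²J = δ²J^{1-2/p} = δ²J^{2θ}, which the stationarity condition for β evaluates. -/
lemma amplitude_sq_mul : amplitude p ν η δ ψ ^ 2 *
      truncIntegral p ν η (constBeta p ν η δ ψ) ψ =
    (2 * Real.pi) ^ (d : ℝ) *
      (d * constBeta p ν η δ ψ * gammaT d p ν η / (1 - gammaT d p ν η)) := by
  have hβ := constBeta_pos hd hp hη hην hδ hI
  have hJ := truncIntegral_pos hd hp hη hην hβ hI
  rw [← truncIntegral_constBeta hd hp hη hην hδ hI, amplitude, mul_pow,
    ← Real.rpow_mul_natCast hJ.le, mul_assoc (δ ^ 2), ← Real.rpow_add_one hJ.ne',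
    Real.rpow_neg (by positivity)]
  have : -(p⁻¹).toReal * (2 : ℕ) + 1 = 2 * thetaP p := by
    unfold thetaP; push_cast; ring
  rw [this]
  field_simp

lemma amplitude_pos : 0 < amplitude p ν η δ ψ := by
  have hβ := constBeta_pos hd hp hη hην hδ hI
  have hJ := truncIntegral_pos hd hp hη hην hβ hI
  unfold amplitude
  positivity

include hhom hcont

omit hd hp hδ hI in
lemma measurable_extremal : Measurable (extremal p ν η δ ψ) := by
  have hψm := measurable_norm_of_homogeneous hhom hcont
  have hSm : Measurable (powSum ν : E d → ℝ) := (continuous_powSum (by linarith)).measurable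
  unfold extremal
  fun_prop (disch := assumption)

/-- For finite p, |f|^p = A^p (|ψ|² - βS)₊^r, and A = δJ^{-1/p} normalises the norm to δ. -/
lemma eLpNorm_extremal_le :
    eLpNorm (fun ξ => (extremal p ν η δ ψ ξ : ℂ)) p volume ≤ ENNReal.ofReal δ := by
  have hβ := constBeta_pos hd hp hη hην hδ hI
  have hJ := truncIntegral_pos hd hp hη hην hβ hI
  have hc := amplitude_pos hd hp hη hην hδ hI
  rcases eq_or_ne p ∞ with rfl | hp'
  · rw [eLpNorm_exponent_top]
    refine (eLpNormEssSup_le_of_ae_bound (C := δ) (Filter.Eventually.of_forall fun ξ => ?_))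
    rw [Complex.norm_real, extremal, amplitude]
    simp only [ENNReal.inv_top, ENNReal.toReal_zero, mul_zero, neg_zero, Real.rpow_zero, mul_one]
    rw [norm_mul, Real.norm_of_nonneg hδ.le, Real.norm_of_nonneg (truncPow_nonneg _ _)]
    refine mul_le_of_le_one_right hδ.le ?_
    -- Here the exponent r/p is 0, and the convention for `truncPow` makes f equal to δ times the
    -- indicator of {|ψ|² > βS}.
    unfold truncPow
    split_ifs <;> simp
  · have hp0 : 0 < p.toReal := ENNReal.toReal_pos (by positivity) hp'
    rw [eLpNorm_eq_lintegral_rpow_enorm_toReal (by positivity) hp']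
    have e1 : ∀ ξ : E d, ‖(extremal p ν η δ ψ ξ : ℂ)‖ₑ ^ p.toReal =
        ENNReal.ofReal (amplitude p ν η δ ψ ^ p.toReal) * ENNReal.ofReal
          (truncPow (conjExp p) (‖ψ ξ‖ ^ 2 - constBeta p ν η δ ψ * powSum ν ξ)) := by
      intro ξ
      have ht := truncPow_nonneg (conjExp p * (p⁻¹).toReal)
        (‖ψ ξ‖ ^ 2 - constBeta p ν η δ ψ * powSum ν ξ)
      rw [← ofReal_norm, Complex.norm_real, extremal, Real.norm_of_nonneg (by positivity),
        ENNReal.ofReal_rpow_of_nonneg (by positivity) hp0.le, Real.mul_rpow hc.le ht,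
        truncPow_rpow hp0.ne', ENNReal.ofReal_mul (by positivity), ENNReal.toReal_inv,
        inv_mul_cancel_right₀ hp0.ne']
    simp only [e1]
    rw [lintegral_const_mul' _ _ ENNReal.ofReal_ne_top,
      lintegral_truncPow_conjExp hd hp hη hην hhom hcont hβ, ← ENNReal.ofReal_mul (by positivity),
      ENNReal.ofReal_rpow_of_pos (by positivity), Real.mul_rpow (by positivity) hJ.le,
      ← Real.rpow_mul hc.le, mul_one_div_cancel hp0.ne', Real.rpow_one, amplitude,
      ENNReal.toReal_inv, mul_assoc, ← Real.rpow_add hJ]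
    simp

lemma lintegral_powSum_mul_extremal_sq :
    ∫⁻ ξ : E d, ENNReal.ofReal (powSum ν ξ * extremal p ν η δ ψ ξ ^ 2) =
      ENNReal.ofReal ((2 * Real.pi) ^ (d : ℝ) * d) := by
  have hβ := constBeta_pos hd hp hη hην hδ hI
  have hγ0 := gammaT_pos (d := d) hp hη hην
  have hγ1 : 0 < 1 - gammaT d p ν η := by linarith [gammaT_lt_one hd hp hη hην]
  have hc := amplitude_sq_mul hd hp hη hην hδ hI
  have e1 : ∀ ξ : E d, ENNReal.ofReal (powSum ν ξ * extremal p ν η δ ψ ξ ^ 2) =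
      ENNReal.ofReal (amplitude p ν η δ ψ ^ 2) * ENNReal.ofReal (powSum ν ξ *
        truncPow (conjExp p - 1) (‖ψ ξ‖ ^ 2 - constBeta p ν η δ ψ * powSum ν ξ)) := by
    intro ξ
    rw [extremal_sq hp, ← ENNReal.ofReal_mul (sq_nonneg _)]
    ring_nf
  simp only [e1]
  rw [lintegral_const_mul' _ _ ENNReal.ofReal_ne_top,
    lintegral_powSum_mul_truncPow_conjExp hd hp hη hην hhom hcont hβ,
    ← ENNReal.ofReal_mul (sq_nonneg _), mul_div_assoc, ← mul_assoc, hc]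
  congr 1
  field_simp

/-- On the support of f the splitting |ψ|² = βS + (|ψ|² - βS)₊ is exact, and (|ψ|² - βS) f² =
A²(|ψ|² - βS)₊^r. The two integrals add up to (2π)^d (dβ + dβγ/(1-γ)). -/
lemma lintegral_norm_sq_mul_extremal_sq :
    ∫⁻ ξ : E d, ENNReal.ofReal (‖ψ ξ‖ ^ 2 * extremal p ν η δ ψ ξ ^ 2) =
      ENNReal.ofReal ((2 * Real.pi) ^ (d : ℝ) * (constK p ν η ψ * δ ^ gammaT d p ν η) ^ 2) := by
  have hβ := constBeta_pos hd hp hη hην hδ hI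
  have hγ0 := gammaT_pos (d := d) hp hη hην
  have hγ1 : 0 < 1 - gammaT d p ν η := by linarith [gammaT_lt_one hd hp hη hην]
  have hc := amplitude_sq_mul hd hp hη hην hδ hI
  have hd' : (0 : ℝ) < d := by exact_mod_cast hd
  have hψm := measurable_norm_of_homogeneous hhom hcont
  have hSm : Measurable (powSum ν : E d → ℝ) := (continuous_powSum (by linarith)).measurable
  have e1 : ∀ ξ : E d, ENNReal.ofReal (‖ψ ξ‖ ^ 2 * extremal p ν η δ ψ ξ ^ 2) =
      ENNReal.ofReal (constBeta p ν η δ ψ) *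
        ENNReal.ofReal (powSum ν ξ * extremal p ν η δ ψ ξ ^ 2) +
      ENNReal.ofReal (amplitude p ν η δ ψ ^ 2) * ENNReal.ofReal
        (truncPow (conjExp p) (‖ψ ξ‖ ^ 2 - constBeta p ν η δ ψ * powSum ν ξ)) := by
    intro ξ
    have hS := powSum_nonneg (ν := ν) ξ
    have ht := truncPow_nonneg (conjExp p) (‖ψ ξ‖ ^ 2 - constBeta p ν η δ ψ * powSum ν ξ)
    rw [← ENNReal.ofReal_mul hβ.le, ← ENNReal.ofReal_mul (sq_nonneg _),
      ← ENNReal.ofReal_add (by positivity) (by positivity), extremal_sq hp]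
    congr 1
    set X := ‖ψ ξ‖ ^ 2 - constBeta p ν η δ ψ * powSum ν ξ with hX
    have e2 : X * truncPow (conjExp p - 1) X = truncPow (conjExp p) X := by
      rcases lt_or_ge 0 X with hx | hx
      · rw [truncPow_of_pos hx, truncPow_of_pos hx, Real.rpow_sub_one hx.ne']
        field_simp
      · rw [truncPow_of_nonpos hx, truncPow_of_nonpos hx, mul_zero]
    rw [← e2, hX]
    ring
  simp only [e1]
  have hm : Measurable fun ξ : E d => ENNReal.ofReal (amplitude p ν η δ ψ ^ 2) * ENNReal.ofReal
      (truncPow (conjExp p) (‖ψ ξ‖ ^ 2 - constBeta p ν η δ ψ * powSum ν ξ)) := by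
    fun_prop (disch := assumption)
  rw [lintegral_add_right _ hm, lintegral_const_mul' _ _ ENNReal.ofReal_ne_top,
    lintegral_const_mul' _ _ ENNReal.ofReal_ne_top,
    lintegral_powSum_mul_extremal_sq hd hp hη hην hδ hhom hcont hI,
    lintegral_truncPow_conjExp hd hp hη hην hhom hcont hβ, ← ENNReal.ofReal_mul hβ.le,
    ← ENNReal.ofReal_mul (sq_nonneg _), hc, ← ENNReal.ofReal_add (by positivity) (by positivity),
    ← constBeta_mul_eq_sq hd hp hη hην hδ hI]
  congr 1
  field_simp
  ring

/-- The d coordinate integrals agree because ψ and S are invariant under interchanges, and their sum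
is d(2π)^d. -/
lemma lintegral_derivSymbol_mul_extremal
    (hsymm : ∀ (j m : Fin d) (ξ : E d),
      ψ (WithLp.toLp 2 fun k => ξ (Equiv.swap j m k)) = ψ ξ) (j : Fin d) :
    ∫⁻ ξ, ‖derivSymbol d ν j ξ * (extremal p ν η δ ψ ξ : ℂ)‖ₑ ^ 2 =
      ENNReal.ofReal ((2 * Real.pi) ^ (d : ℝ)) := by
  have hm := measurable_extremal (p := p) (δ := δ) hη hην hhom hcont
  have hν : 0 < ν := by linarith
  have hd' : (0 : ℝ) < d := by exact_mod_cast hd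
  have hs := sum_lintegral_derivSymbol (d := d) hν
    (Complex.measurable_ofReal.comp hm).aestronglyMeasurable
  have hsq : ∀ ξ : E d, ‖(extremal p ν η δ ψ ξ : ℂ)‖ ^ 2 = extremal p ν η δ ψ ξ ^ 2 := fun ξ => by
    rw [Complex.norm_real, Real.norm_eq_abs, sq_abs]
  have hinv : ∀ j m ξ, extremal p ν η δ ψ (swapCoord d j m ξ) ^ 2 = extremal p ν η δ ψ ξ ^ 2 := by
    intro j m ξ
    have : ψ (swapCoord d j m ξ) = ψ ξ := by rw [swapCoord_apply, hsymm]
    rw [extremal, extremal, powSum_swapCoord, this]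
  have heq : ∀ m : Fin d,
      ∫⁻ ξ, ‖derivSymbol d ν m ξ * (extremal p ν η δ ψ ξ : ℂ)‖ₑ ^ 2 =
      ∫⁻ ξ, ‖derivSymbol d ν j ξ * (extremal p ν η δ ψ ξ : ℂ)‖ₑ ^ 2 := by
    intro m
    simp only [enorm_derivSymbol_mul_sq hν, hsq]
    exact lintegral_coord_eq (hm.pow_const 2) hinv m j
  simp only [Function.comp_apply, hsq] at hs
  rw [lintegral_powSum_mul_extremal_sq hd hp hη hην hδ hhom hcont hI] at hs
  simp only [heq, Finset.sum_const, Finset.card_univ, Fintype.card_fin, nsmul_eq_mul] at hs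
  rw [mul_comm ((2 * Real.pi) ^ (d : ℝ)), ENNReal.ofReal_mul hd'.le, ENNReal.ofReal_natCast] at hs
  exact (ENNReal.mul_right_inj (by exact_mod_cast hd.ne') (ENNReal.natCast_ne_top d)).1 hs

lemma exists_extremal [Fact (1 ≤ p)] (hψ : AEStronglyMeasurable ψ volume)
    (hsymm : ∀ (j m : Fin d) (ξ : E d),
      ψ (WithLp.toLp 2 fun k => ξ (Equiv.swap j m k)) = ψ ξ) :
    ∃ f : Lp ℂ p (volume : Measure (E d)), ‖f‖ₑ ≤ ENNReal.ofReal δ ∧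
      (∀ j, MemLp (fun ξ => derivSymbol d ν j ξ * f ξ) 2 volume ∧
        plancherelConst d * eLpNorm (fun ξ => derivSymbol d ν j ξ * f ξ) 2 volume ≤ 1) ∧
      MemLp (fun ξ => ψ ξ * f ξ) 2 volume ∧
      plancherelConst d * eLpNorm (fun ξ => ψ ξ * f ξ) 2 volume =
        ENNReal.ofReal (constK p ν η ψ * δ ^ gammaT d p ν η) := by
  have hm := Complex.measurable_ofReal.comp
    (measurable_extremal (p := p) (δ := δ) hη hην hhom hcont)
  have hK := constK_pos hd hp hη hην hI
  have hle := eLpNorm_extremal_le hd hp hη hην hδ hhom hcont hI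
  have hmem : MemLp (fun ξ => (extremal p ν η δ ψ ξ : ℂ)) p volume :=
    ⟨hm.aestronglyMeasurable, hle.trans_lt ENNReal.ofReal_lt_top⟩
  have hae := hmem.coeFn_toLp
  have hj : ∀ j, eLpNorm (fun ξ => derivSymbol d ν j ξ * hmem.toLp _ ξ) 2 volume ^ 2 =
      ENNReal.ofReal ((2 * Real.pi) ^ (d : ℝ)) := by
    intro j
    rw [← lintegral_derivSymbol_mul_extremal hd hp hη hην hδ hhom hcont hI hsymm j,
      eLpNorm_two_sq]
    refine lintegral_congr_ae ?_
    filter_upwards [hae] with ξ hξ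
    rw [hξ]
  have hψe : eLpNorm (fun ξ => ψ ξ * hmem.toLp _ ξ) 2 volume ^ 2 =
      ENNReal.ofReal ((2 * Real.pi) ^ (d : ℝ) * (constK p ν η ψ * δ ^ gammaT d p ν η) ^ 2) := by
    rw [← lintegral_norm_sq_mul_extremal_sq hd hp hη hην hδ hhom hcont hI, eLpNorm_two_sq]
    refine lintegral_congr_ae ?_
    filter_upwards [hae] with ξ hξ
    rw [hξ, ← ofReal_norm, norm_mul, ← ENNReal.ofReal_pow (by positivity), mul_pow,
      Complex.norm_real, Real.norm_eq_abs, sq_abs]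
  have hfin : ∀ {g : E d → ℂ} {c : ℝ}, eLpNorm g 2 volume ^ 2 = ENNReal.ofReal c →
      eLpNorm g 2 volume < ∞ := fun h =>
    (ENNReal.pow_lt_top_iff (n := 2)).1 (h.trans_lt ENNReal.ofReal_lt_top) |>.resolve_right
      two_ne_zero
  have hσ : (2 * Real.pi) ^ (-(d : ℝ)) * (2 * Real.pi) ^ (d : ℝ) = 1 := by
    rw [← Real.rpow_add (by positivity)]
    simp
  refine ⟨hmem.toLp _, by rwa [Lp.enorm_toLp], fun j => ⟨⟨?_, hfin (hj j)⟩, ?_⟩,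
    ⟨hψ.mul (Lp.aestronglyMeasurable _), hfin hψe⟩, ?_⟩
  · exact (measurable_derivSymbol j).aestronglyMeasurable.mul (Lp.aestronglyMeasurable _)
  · refine (ENNReal.pow_le_pow_left_iff two_ne_zero).1 ?_
    rw [mul_pow, hj, plancherelConst_sq, ← ENNReal.ofReal_mul (by positivity), hσ]
    simp
  · refine (ENNReal.pow_right_strictMono two_ne_zero).injective ?_
    rw [mul_pow, hψe, plancherelConst_sq, ← ENNReal.ofReal_mul (by positivity), ← mul_assoc, hσ,
      one_mul, ENNReal.ofReal_pow (by positivity)]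

end Extremal

/-! ### The lower bound for arbitrary methods -/

section Recovery

variable {d : ℕ} {p : ℝ≥0∞} [Fact (1 ≤ p)] {ν η δ : ℝ} {ψ : E d → ℂ}

lemma F_neg (x : 𝓢'(E d, ℂ)) : F (-x) = -F x := rfl

lemma Finv_neg (x : 𝓢'(E d, ℂ)) : Finv (-x) = -Finv x := rfl

lemma mem_classW {n : ℕ} {φ : Fin n → E d → ℂ} {x : 𝓢'(E d, ℂ)}
    {f : Lp ℂ p (volume : Measure (E d))} (hx : F x = (f : 𝓢'(E d, ℂ)))
    (hf : ∀ j, MemLp (fun ξ => φ j ξ * f ξ) 2 volume ∧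
      plancherelConst d * eLpNorm (fun ξ => φ j ξ * f ξ) 2 volume ≤ 1) : x ∈ classW p φ :=
  ⟨⟨f, hx, fun j => (hf j).1⟩, fun j => by rw [lqNorm_multOp hx (hf j).1]; exact (hf j).2⟩

/-- Lower bound for the error of optimal recovery: no method distinguishes `x` and `-x` from the
data `y = 0`. -/
lemma le_optimalError {n : ℕ} {φ : Fin n → E d → ℂ} {f : Lp ℂ p (volume : Measure (E d))}
    (hfδ : ‖f‖ₑ ≤ ENNReal.ofReal δ)
    (hf : ∀ j, MemLp (fun ξ => φ j ξ * f ξ) 2 volume ∧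
      plancherelConst d * eLpNorm (fun ξ => φ j ξ * f ξ) 2 volume ≤ 1)
    (hψf : MemLp (fun ξ => ψ ξ * f ξ) 2 volume) :
    plancherelConst d * eLpNorm (fun ξ => ψ ξ * f ξ) 2 volume ≤ optimalError p ψ φ δ := by
  refine le_iInf fun m => ?_
  have hx : F (Finv (f : 𝓢'(E d, ℂ))) = (f : 𝓢'(E d, ℂ)) := F_Finv _
  have hx' : F (-Finv (f : 𝓢'(E d, ℂ))) =
      ((-f : Lp ℂ p (volume : Measure (E d))) : 𝓢'(E d, ℂ)) := by
    rw [F_neg, hx, toTemperedDistribution_neg]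
  have hneg : ∀ φ : E d → ℂ, (fun ξ => φ ξ * (-f : Lp ℂ p (volume : Measure (E d))) ξ)
      =ᵐ[volume] -fun ξ => φ ξ * f ξ := by
    intro φ
    filter_upwards [Lp.coeFn_neg f] with ξ hξ
    rw [hξ]
    simp
  have hxW := mem_classW hx hf
  have hxW' : -Finv (f : 𝓢'(E d, ℂ)) ∈ classW p φ := by
    refine mem_classW hx' fun j => ⟨(hf j).1.neg.ae_eq (hneg _).symm, ?_⟩
    rw [eLpNorm_congr_ae (hneg _), eLpNorm_neg]
    exact (hf j).2
  obtain ⟨g, hg, -⟩ := exists_toTemperedDistribution_eq_Finv (hψf.toLp _)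
  have hΛ : multOp ψ (Finv (f : 𝓢'(E d, ℂ))) = (g : 𝓢'(E d, ℂ)) := by
    rw [hg, multOp_eq hx hψf.coeFn_toLp]
  have hΛ' : multOp ψ (-Finv (f : 𝓢'(E d, ℂ))) =
      ((-g : Lp ℂ 2 (volume : Measure (E d))) : 𝓢'(E d, ℂ)) := by
    rw [toTemperedDistribution_neg, hg, multOp_eq hx' (h := -hψf.toLp _),
      toTemperedDistribution_neg, Finv_neg]
    refine (Lp.coeFn_neg _).trans (Filter.EventuallyEq.trans ?_ (hneg ψ).symm)
    exact hψf.coeFn_toLp.neg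
  have hy : lqNorm p (F (Finv (f : 𝓢'(E d, ℂ))) -
      ((0 : Lp ℂ p (volume : Measure (E d))) : 𝓢'(E d, ℂ))) ≤ ENNReal.ofReal δ := by
    rwa [hx, ← toTemperedDistribution_sub, lqNorm_toTemperedDistribution, sub_zero]
  have hy' : lqNorm p (F (-Finv (f : 𝓢'(E d, ℂ))) -
      ((0 : Lp ℂ p (volume : Measure (E d))) : 𝓢'(E d, ℂ))) ≤ ENNReal.ofReal δ := by
    rwa [hx', ← toTemperedDistribution_sub, lqNorm_toTemperedDistribution, sub_zero, enorm_neg]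
  have h1 : ‖g - m 0‖ₑ ≤ methodError p ψ φ δ m := by
    refine le_trans (le_of_eq ?_) (le_iSup₂_of_le _ hxW (le_iSup₂_of_le 0 hy le_rfl))
    rw [hΛ, ← toTemperedDistribution_sub, lqNorm_toTemperedDistribution]
  have h2 : ‖-g - m 0‖ₑ ≤ methodError p ψ φ δ m := by
    refine le_trans (le_of_eq ?_) (le_iSup₂_of_le _ hxW' (le_iSup₂_of_le 0 hy' le_rfl))
    rw [hΛ', ← toTemperedDistribution_sub, lqNorm_toTemperedDistribution]
  rw [← lqNorm_multOp hx hψf, hΛ, lqNorm_toTemperedDistribution]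
  -- Both ±g are approximated by the same element m(0), so the triangle inequality bounds ‖2g‖ by
  -- twice the error.
  have h3 : ‖g + g‖ₑ ≤ methodError p ψ φ δ m + methodError p ψ φ δ m := by
    have : g + g = (g - m 0) - (-g - m 0) := by abel
    rw [this]
    exact enorm_sub_le.trans (add_le_add h1 h2)
  rw [← two_smul ℝ, enorm_smul, ← two_mul] at h3
  have h4 : ‖(2 : ℝ)‖ₑ = 2 := by
    rw [← ofReal_norm]; simp
  rw [h4] at h3
  exact (ENNReal.mul_le_mul_iff_right two_ne_zero ENNReal.ofNat_ne_top).1 h3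

lemma F_sub_coe {x : 𝓢'(E d, ℂ)} {f : Lp ℂ p (volume : Measure (E d))}
    (hx : F x = (f : 𝓢'(E d, ℂ))) (y : Lp ℂ p (volume : Measure (E d))) :
    lqNorm p (F x - (y : 𝓢'(E d, ℂ))) = eLpNorm (fun ξ => f ξ - y ξ) p volume := by
  rw [hx, ← toTemperedDistribution_sub, lqNorm_toTemperedDistribution, Lp.enorm_def]
  exact eLpNorm_congr_ae (Lp.coeFn_sub f y)

end Recovery

end OptRecovery

/-! ### The theorem -/

open OptRecovery
theorem corollary7 (d : ℕ) (hd : 0 < d) (p : ℝ≥0∞) [Fact (1 ≤ p)] (hp : 2 < p)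
    (ν η δ : ℝ) (hη : 0 ≤ η) (hην : η < ν) (hδ : 0 < δ)
    (ψ : E d → ℂ) (hψ_meas : AEStronglyMeasurable ψ volume)
    (hψ_hom : ∀ t : ℝ, 0 < t → ∀ ξ : E d, ‖ψ (t • ξ)‖ = t ^ η * ‖ψ ξ‖)
    (hψ_ne : ∀ᵐ ξ : E d, ψ ξ ≠ 0)
    (hψ_symm : ∀ (j m : Fin d) (ξ : E d),
      ψ (WithLp.toLp 2 fun k => ξ (Equiv.swap j m k)) = ψ ξ)
    (hψ_cont : Continuous fun ω : Metric.sphere (0 : E d) 1 => ‖ψ ω‖) :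
    -- the integral `I` is finite
    Integrable (integrandI p ν η ψ) (volume : Measure (E d)).toSphere ∧
    -- `Λ` maps `X_p` to `L_2`
    (∀ x ∈ spaceX p (derivSymbol d ν),
      MemLp (fun ξ => ψ ξ * density (F x) ξ) 2 volume ∧ lqNorm 2 (multOp ψ x) < ∞) ∧
    -- the error of optimal recovery
    optimalError p ψ (derivSymbol d ν) δ =
      ENNReal.ofReal (constK p ν η ψ * δ ^ gammaT d p ν η) ∧
    -- the filter method is well defined and optimal
    (∃ m : Method d p,
      (∀ y : Lp ℂ p (volume : Measure (E d)),
        MemLp (fun ξ => filter p ν η δ ψ ξ * y ξ) 2 volume ∧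
        (m y : 𝓢'(E d, ℂ)) = Finv (funcDist fun ξ => filter p ν η δ ψ ξ * y ξ)) ∧
      methodError p ψ (derivSymbol d ν) δ m = optimalError p ψ (derivSymbol d ν) δ) ∧
    -- the sharp inequality
    IsLeast {K : ℝ | 0 ≤ K ∧ ∀ x ∈ spaceX p (derivSymbol d ν),
        lqNorm 2 (multOp ψ x) ≤ ENNReal.ofReal K * lqNorm p (F x) ^ gammaT d p ν η *
          (⨆ j : Fin d, lqNorm 2 (multOp (derivSymbol d ν j) x)) ^ (1 - gammaT d p ν η)}
      (constK p ν η ψ) := by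
  have hI : 0 < constI p ν η ψ := constI_pos hd hp hη hην hψ_hom hψ_ne hψ_cont
  have hK := constK_pos hd hp hη hην hI
  have hγ0 := gammaT_pos (d := d) hp hη hην
  have hγ1 : 0 < 1 - gammaT d p ν η := by linarith [gammaT_lt_one hd hp hη hην]
  have hψmul : ∀ {f : Lp ℂ p (volume : Measure (E d))},
      (∀ j, MemLp (fun ξ => derivSymbol d ν j ξ * f ξ) 2 volume) →
      MemLp (fun ξ => ψ ξ * f ξ) 2 volume := fun hfj =>
    memLp_mul hd hp hη hην hψ_hom hψ_cont hψ_meas hI (Lp.memLp _) hfj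
  have hlow : ENNReal.ofReal (constK p ν η ψ * δ ^ gammaT d p ν η) ≤
      optimalError p ψ (derivSymbol d ν) δ := by
    obtain ⟨f, hfδ, hf, hψf, he⟩ :=
      exists_extremal hd hp hη hην hδ hψ_hom hψ_cont hI hψ_meas hψ_symm
    rw [← he]
    exact le_optimalError hfδ hf hψf
  have hfilter : ∀ y : Lp ℂ p (volume : Measure (E d)),
      MemLp (fun ξ => filter p ν η δ ψ ξ * y ξ) 2 volume := fun y =>
    memLp_filter_mul hd hp hη hην hψ_hom hψ_cont hψ_meas hI hδ (Lp.memLp y)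
  choose m hm using fun y => exists_toTemperedDistribution_eq_Finv ((hfilter y).toLp _)
  have hup : methodError p ψ (derivSymbol d ν) δ m ≤
      ENNReal.ofReal (constK p ν η ψ * δ ^ gammaT d p ν η) := by
    refine iSup₂_le fun x hx => iSup₂_le fun y hy => ?_
    obtain ⟨⟨f, hFx, hfj⟩, hxj⟩ := hx
    rw [F_sub_coe hFx] at hy
    have hψf := hψmul hfj
    have e : multOp ψ x - (m y : 𝓢'(E d, ℂ)) =
        Finv (funcDist ((fun ξ => ψ ξ * f ξ) - fun ξ => filter p ν η δ ψ ξ * y ξ)) := by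
      rw [(hm y).1, multOp_eq hFx hψf.coeFn_toLp, ← Finv_sub, funcDist_sub hψf (hfilter y),
        funcDist_eq_toLp hψf, funcDist_eq_toLp (hfilter y)]
    rw [e, lqNorm_Finv_funcDist (hψf.sub (hfilter y)), ← plancherelConst]
    -- The noise level gives A = δ, the class W_p gives D = 1.
    have h := plancherelConst_mul_eLpNorm_le (A := δ) (D := 1) (f := f) (z := fun ξ => f ξ - y ξ)
      (w := (fun ξ => ψ ξ * f ξ) - fun ξ => filter p ν η δ ψ ξ * y ξ)
      hd hp hη hην hψ_hom hψ_cont hI hδ one_pos (Lp.aestronglyMeasurable f)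
      ((Lp.aestronglyMeasurable f).sub (Lp.aestronglyMeasurable y))
      (fun j => by
        rw [← lqNorm_multOp hFx (hfj j), ENNReal.ofReal_one]
        exact hxj j) hy
      (fun ξ => by
        rw [div_one]
        exact norm_sub_filter_mul_sq_le (constBeta_pos hd hp hη hην hδ hI).le ξ (f ξ) (y ξ))
    simpa using h
  have hopt : optimalError p ψ (derivSymbol d ν) δ =
      ENNReal.ofReal (constK p ν η ψ * δ ^ gammaT d p ν η) :=
    le_antisymm ((iInf_le _ m).trans hup) hlow
  refine ⟨integrable_integrandI hp hη hην hψ_cont, ?_, hopt, ⟨m, fun y => ⟨hfilter y, ?_⟩, ?_⟩,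
    ⟨hK.le, ?_⟩, ?_⟩
  · rintro x ⟨f, hFx, hfj⟩
    have hψf := hψmul hfj
    constructor
    · refine hψf.ae_eq ?_
      rw [hFx]
      filter_upwards [density_ae_eq (isDensity_toTemperedDistribution f)] with ξ hξ
      rw [hξ]
    · rw [lqNorm_multOp hFx hψf]
      exact ENNReal.mul_lt_top ENNReal.ofReal_lt_top hψf.2
  · rw [(hm y).1, funcDist_eq_toLp (hfilter y)]
  · exact le_antisymm (hup.trans hlow) (iInf_le _ m)
  · rintro x ⟨f, hFx, hfj⟩
    have hψf := hψmul hfj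
    rw [lqNorm_multOp hFx hψf, hFx, lqNorm_toTemperedDistribution]
    set D := ⨆ j : Fin d, lqNorm 2 (multOp (derivSymbol d ν j) x) with hD
    have hjD : ∀ j, plancherelConst d *
        eLpNorm (fun ξ => derivSymbol d ν j ξ * f ξ) 2 volume ≤ D := fun j => by
      rw [← lqNorm_multOp hFx (hfj j)]
      exact le_iSup (fun j : Fin d => lqNorm 2 (multOp (derivSymbol d ν j) x)) j
    have hDtop : D ≠ ∞ := by
      have hsum : ∑ j, lqNorm 2 (multOp (derivSymbol d ν j) x) < ∞ :=
        ENNReal.sum_lt_top.2 fun j _ => by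
          rw [lqNorm_multOp hFx (hfj j)]
          exact ENNReal.mul_lt_top ENNReal.ofReal_lt_top (hfj j).2
      refine ((iSup_le fun j => ?_).trans_lt hsum).ne
      exact Finset.single_le_sum (f := fun j => lqNorm 2 (multOp (derivSymbol d ν j) x))
        (fun _ _ => zero_le) (Finset.mem_univ j)
    clear_value D
    lift D to NNReal using hDtop
    -- The estimate needs A, D > 0, while either norm may vanish. Both are enlarged by ε, and ε → 0
    -- is harmless because the exponents γ and 1 - γ are positive.
    have hlim : Filter.Tendsto (fun ε : ℝ => ENNReal.ofReal (constK p ν η ψ *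
        (‖f‖ + ε) ^ gammaT d p ν η * ((D : ℝ) + ε) ^ (1 - gammaT d p ν η))) (nhdsWithin 0 (Set.Ioi 0))
        (nhds (ENNReal.ofReal (constK p ν η ψ *
        (‖f‖ + 0) ^ gammaT d p ν η * ((D : ℝ) + 0) ^ (1 - gammaT d p ν η)))) := by
      refine Filter.Tendsto.mono_left (Continuous.tendsto ?_ 0) nhdsWithin_le_nhds
      refine ENNReal.continuous_ofReal.comp ?_
      exact (continuous_const.mul ((by fun_prop : Continuous fun ε : ℝ => ‖f‖ + ε).rpow_const
        fun _ => Or.inr hγ0.le)).mul ((by fun_prop : Continuous fun ε : ℝ => (D : ℝ) + ε).rpow_const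
        fun _ => Or.inr hγ1.le)
    have hle := ge_of_tendsto hlim (b := plancherelConst d *
        eLpNorm (fun ξ => ψ ξ * f ξ) 2 volume) (by
      filter_upwards [self_mem_nhdsWithin] with ε hε
      have hε : 0 < ε := hε
      refine plancherelConst_mul_eLpNorm_le (f := f) (z := f) hd hp hη hην hψ_hom hψ_cont hI
        (by positivity) (by positivity) (Lp.aestronglyMeasurable f) (Lp.aestronglyMeasurable f)
        (fun j => (hjD j).trans ?_) ?_ (norm_mul_sq_le _ f)
      · rw [← ENNReal.ofReal_coe_nnreal]
        exact ENNReal.ofReal_le_ofReal (by linarith)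
      · rw [← Lp.enorm_def, ← ofReal_norm]
        exact ENNReal.ofReal_le_ofReal (by linarith))
    refine hle.trans (le_of_eq ?_)
    rw [add_zero, add_zero, ENNReal.ofReal_mul (by positivity), ENNReal.ofReal_mul hK.le,
      ← ENNReal.ofReal_rpow_of_nonneg (norm_nonneg _) hγ0.le, ofReal_norm,
      ← ENNReal.ofReal_rpow_of_nonneg (NNReal.coe_nonneg _) hγ1.le, ENNReal.ofReal_coe_nnreal]
  · rintro K ⟨hK0, hKx⟩
    -- For δ = 1 the extremal function has both norms on the right at most 1, while the left side
    -- equals `constK p ν η ψ`.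
    obtain ⟨f, hfδ, hf, hψf, he⟩ :=
      exists_extremal hd hp hη hην one_pos hψ_hom hψ_cont hI hψ_meas hψ_symm
    have hFx : F (Finv (f : 𝓢'(E d, ℂ))) = (f : 𝓢'(E d, ℂ)) := F_Finv _
    have h := hKx _ ⟨f, hFx, fun j => (hf j).1⟩
    rw [lqNorm_multOp hFx hψf, he, hFx, lqNorm_toTemperedDistribution, Real.one_rpow, mul_one] at h
    rw [ENNReal.ofReal_one] at hfδ
    have h2 : (⨆ j : Fin d, lqNorm 2 (multOp (derivSymbol d ν j) (Finv (f : 𝓢'(E d, ℂ))))) ≤ 1 :=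
      iSup_le fun j => by rw [lqNorm_multOp hFx (hf j).1]; exact (hf j).2
    refine (ENNReal.ofReal_le_ofReal_iff hK0).1 (h.trans ?_)
    calc _ ≤ ENNReal.ofReal K * 1 * 1 := by
          gcongr
          · exact ENNReal.rpow_le_one hfδ hγ0.le
          · exact ENNReal.rpow_le_one h2 hγ1.le
      _ = ENNReal.ofReal K := by simp
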